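/- A \emph{drawing} $D$ of a graph $G$ in the plane represents the vertices of $G$ by distinct points and every edge by a simple arc that joins the points of its two end vertices and contains no other vertex. Two different edges \emph{cross} at a point $p$ if $p$ lies on both of their arcs and is not a vertex. Let $\operatorname{cr}(D)$ be the number of crossings of $D$, that is, the number of unordered pairs of edges that cross, a pair being counted once for each point at which it crosses. The drawing is \emph{rectilinear} if its vertices are in general position (no three on a line) and every edge is a straight-line segment; in such a drawing every pair of edges crosses at most once, so $\operatorname{cr}(D)$ is then simply the number of pairs of edges that cross. Let $\operatorname{cr}(G)$ be the minimum of $\operatorname{cr}(D)$ over all drawings $D$ of $G$ in the plane, and let $\overline{\operatorname{cr}}(G)$ be the minimum of $\operatorname{cr}(D)$ over all rectilinear drawings $D$ of $G$ in the plane. \textbf{Proposition.} For every integer $n \ge 10$, \[ \operatorname{cr}(K_n) < \overline{\operatorname{cr}}(K_n), \] where $K_n$ is the complete graph on $n$ vertices. -/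

import Mathlib

namespace GraphDrawing

/-- The Euclidean plane. -/
abbrev Plane : Type := EuclideanSpace ℝ (Fin 2)

/-- `S` is a simple arc with ends `a` and `b`: the image of an injective path from `a` to `b`. -/
def IsSimpleArc (a b : Plane) (S : Set Plane) : Prop :=
  ∃ γ : Path a b, Function.Injective γ ∧ Set.range γ = S

/-- A drawing of a graph in the plane: the vertices are distinct points, every edge is a simple
arc joining its two end vertices, and no edge passes through any other vertex. -/
structure Drawing {V : Type*} (G : SimpleGraph V) where
  /-- the point that represents a vertex -/
  point : V → Plane
  /-- the point set of the arc that represents an edge -/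
  arc : G.edgeSet → Set Plane
  point_injective : Function.Injective point
  isSimpleArc : ∀ (u v : V) (h : G.Adj u v),
    IsSimpleArc (point u) (point v) (arc ⟨s(u, v), h⟩)
  mem_of_point_mem_arc : ∀ (e : G.edgeSet) (w : V), point w ∈ arc e → w ∈ (e : Sym2 V)

namespace Drawing

variable {V : Type*} {G : SimpleGraph V}

/-- Two different edges cross at `p` if `p` lies on both of them and is not a vertex
(so that `p` is interior to both arcs). -/
def CrossAt (D : Drawing G) (e f : G.edgeSet) (p : Plane) : Prop :=
  e ≠ f ∧ p ∈ D.arc e ∧ p ∈ D.arc f ∧ p ∉ Set.range D.point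

/-- The crossings of a drawing: unordered pairs of edges, with a point where they cross. Thus
`k` edges through one point give `k.choose 2` crossings, and a pair of edges that meets in
several points is counted once for each of them. -/
def crossings (D : Drawing G) : Set (Sym2 G.edgeSet × Plane) :=
  {x | ∃ e f : G.edgeSet, x.1 = s(e, f) ∧ D.CrossAt e f x.2}

/-- The crossing number of a drawing (it is `⊤` if there are infinitely many crossings). -/
noncomputable def cr (D : Drawing G) : ℕ∞ :=
  D.crossings.encard

/-- A drawing is rectilinear if its vertices are in general position (no three of them on a
line) and every edge is the straight-line segment between its end vertices. -/
def IsRectilinear (D : Drawing G) : Prop :=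
  (∀ u v w : V, u ≠ v → u ≠ w → v ≠ w →
    ¬ Collinear ℝ ({D.point u, D.point v, D.point w} : Set Plane)) ∧
  ∀ (u v : V) (h : G.Adj u v), D.arc ⟨s(u, v), h⟩ = segment ℝ (D.point u) (D.point v)

end Drawing

/-- The crossing number of a graph: the minimum over all its drawings. -/
noncomputable def crossingNumber {V : Type*} (G : SimpleGraph V) : ℕ∞ :=
  ⨅ D : Drawing G, D.cr

/-- The rectilinear crossing number of a graph: the minimum over all its rectilinear drawings. -/
noncomputable def rectilinearCrossingNumber {V : Type*} (G : SimpleGraph V) : ℕ∞ :=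
  ⨅ (D : Drawing G) (_ : D.IsRectilinear), D.cr

end GraphDrawing

/-! For four vertices, count the pairs among them that separate the other two (`sixSep`). In a
rectilinear drawing this number is at least 2, and when it equals 2 two complementary pairs separate
each other, so their segments cross (`leftSide_sixSep`). Hence the drawing has at least 3·C(n,4) − Σ
`sixSep` crossings. The two-page drawing, whose edges are parabolic arcs above or below a line of
vertices, has a combinatorial notion of side for which "crossing indicator + `sixSep` = 3" is an
identity (`pageSide_sixSep`), so it has at most 3·C(n,4) − Σ `sixSep` crossings.

Regrouped by pairs, Σ `sixSep` is the sum of L·R over all pairs, where L and R count the points on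
the two sides. This is a sum, with positive weights, of the numbers of pairs having more than t
points on both sides. It therefore suffices to compare, for each t, the numbers of shallow pairs,
those with at most t points on some side. The two-page drawing has at most 3·C(t+2,2) of them
(`shallowPairs_pageSide_le`), and a point set in general position has at least that many
(`fewLeft_ge`).

The lower bound is proved by deleting a hull vertex p. It loses 2(k+1) pairs at p and at least k+1
pairs with exactly k points on the left and p on the right; the latter are found by rotating a line
about each other point.

Strictness (`exists_fewLeft_gt`): if all bounds up to level K+1 were sharp, the hull would have at
most three vertices, and equality in the rotation argument would put every point in at most one pair
per hull vertex. Then at most n directed pairs have exactly K points on the left, whereas sharpness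
requires 3(K+1) of them. Taking K = ⌊n/3⌋ gives a contradiction, at a level whose weight is positive
once n ≥ 10. -/

namespace GraphDrawing

open Finset

/-! ### A discrete intermediate value count on the line. -/

section LevelCrossing

variable {ι : Type*}

/-- For points of two kinds on the real line, the number of points of the first kind above `f b`
plus the number of points of the second kind below `f b`. -/
noncomputable def mixedRank (s : Finset ι) (f : ι → ℝ) (A : ι → Prop) [DecidablePred A]
    (b : ι) : ℕ :=
  #{c ∈ s | A c ∧ f b < f c} + #{c ∈ s | ¬ A c ∧ f c < f b}

/-- The mixed rank changes by one at every point, down at points of the first kind and up at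
points of the second kind; this counts its passages through the level `K + 1 / 2`. -/
theorem level_crossing (s : Finset ι) (f : ι → ℝ) (A : ι → Prop) [DecidablePred A]
    (hf : Set.InjOn f s) (K : ℕ) :
    #{b ∈ s | A b ∧ mixedRank s f A b = K} + (if K < #{b ∈ s | ¬ A b} then 1 else 0) =
      #{b ∈ s | ¬ A b ∧ mixedRank s f A b = K} + (if K < #{b ∈ s | A b} then 1 else 0) := by
  classical
  induction s using Finset.induction_on_max_value f generalizing K with
  | empty => simp
  | insert a s ha hmax ih =>
    have hf' : Set.InjOn f s := hf.mono (by simp)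
    have hlt : ∀ x ∈ s, f x < f a := fun x hx => lt_of_le_of_ne (hmax x hx) fun h =>
      ha (hf (by simp [hx]) (by simp) h ▸ hx)
    -- The new point `a` is the maximum: every second-kind point lies below it, and it raises the
    -- older ranks exactly when it is of the first kind.
    have hnew : mixedRank (insert a s) f A a = #{c ∈ s | ¬ A c} := by
      unfold mixedRank
      rw [filter_insert, filter_insert, if_neg (by simp), if_neg (by simp),
        filter_false_of_mem (fun x hx h => (hlt x hx).not_gt h.2), card_empty, zero_add]
      exact congrArg card (filter_congr fun x hx => and_iff_left (hlt x hx))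
    have hold : ∀ b ∈ s, mixedRank (insert a s) f A b =
        mixedRank s f A b + if A a then 1 else 0 := by
      intro b hb
      unfold mixedRank
      have h2 : ¬ f a < f b := (hlt b hb).not_gt
      by_cases hA : A a
      · simp [filter_insert, hA, hlt b hb, ha]; omega
      · simp [filter_insert, hA, h2]
    by_cases hA : A a
    · have e1 : #{b ∈ insert a s | A b ∧ mixedRank (insert a s) f A b = K} =
          #{b ∈ s | A b ∧ mixedRank s f A b + 1 = K} +
            if #{c ∈ s | ¬ A c} = K then 1 else 0 := by
        rw [filter_insert, hnew]
        have : {b ∈ s | A b ∧ mixedRank (insert a s) f A b = K} =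
            {b ∈ s | A b ∧ mixedRank s f A b + 1 = K} :=
          filter_congr fun b hb => by rw [hold b hb, if_pos hA]
        rw [this]
        split_ifs with h h' h' <;> simp_all
      have e2 : #{b ∈ insert a s | ¬ A b ∧ mixedRank (insert a s) f A b = K} =
          #{b ∈ s | ¬ A b ∧ mixedRank s f A b + 1 = K} := by
        rw [filter_insert, if_neg (by simp [hA])]
        exact congrArg card (filter_congr fun b hb => by rw [hold b hb, if_pos hA])
      have e3 : #{b ∈ insert a s | A b} = #{b ∈ s | A b} + 1 := by
        simp [filter_insert, hA, ha]
      have e4 : #{b ∈ insert a s | ¬ A b} = #{b ∈ s | ¬ A b} := by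
        simp [filter_insert, hA]
      rw [e1, e2, e3, e4]
      cases K with
      | zero =>
        have z1 : #{b ∈ s | A b ∧ mixedRank s f A b + 1 = 0} = 0 := by simp
        have z2 : #{b ∈ s | ¬ A b ∧ mixedRank s f A b + 1 = 0} = 0 := by simp
        rw [z1, z2]
        split_ifs <;> omega
      | succ K =>
        have := ih hf' K
        simp only [Nat.add_right_cancel_iff]
        split_ifs at this ⊢ <;> omega
    · have e1 : #{b ∈ insert a s | A b ∧ mixedRank (insert a s) f A b = K} =
          #{b ∈ s | A b ∧ mixedRank s f A b = K} := by
        rw [filter_insert, if_neg (by simp [hA])]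
        exact congrArg card (filter_congr fun b hb => by rw [hold b hb, if_neg hA, add_zero])
      have e2 : #{b ∈ insert a s | ¬ A b ∧ mixedRank (insert a s) f A b = K} =
          #{b ∈ s | ¬ A b ∧ mixedRank s f A b = K} +
            if #{c ∈ s | ¬ A c} = K then 1 else 0 := by
        rw [filter_insert, hnew]
        have : {b ∈ s | ¬ A b ∧ mixedRank (insert a s) f A b = K} =
            {b ∈ s | ¬ A b ∧ mixedRank s f A b = K} :=
          filter_congr fun b hb => by rw [hold b hb, if_neg hA, add_zero]
        rw [this]
        split_ifs with h h' h' <;> simp_all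
      have e3 : #{b ∈ insert a s | ¬ A b} = #{b ∈ s | ¬ A b} + 1 := by
        simp [filter_insert, hA, ha]
      have e4 : #{b ∈ insert a s | A b} = #{b ∈ s | A b} := by
        simp [filter_insert, hA]
      rw [e1, e2, e3, e4]
      have := ih hf' K
      split_ifs at this ⊢ <;> omega

end LevelCrossing

/-! ### Orientation, left counts, and rotating a line about a point. -/

section Orientation

/-- Twice the signed area of the triangle `a b c`. -/
def orient (a b c : Plane) : ℝ :=
  (b 0 - a 0) * (c 1 - a 1) - (b 1 - a 1) * (c 0 - a 0)

theorem orient_swap (a b c : Plane) : orient b a c = -orient a b c := by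
  unfold orient; ring

theorem orient_rotate (a b c : Plane) : orient b c a = orient a b c := by
  unfold orient; ring

@[simp] theorem orient_self_left (a b : Plane) : orient a b a = 0 := by
  unfold orient; ring

@[simp] theorem orient_self_right (a b : Plane) : orient a b b = 0 := by
  unfold orient; ring

@[simp] theorem orient_self (a b : Plane) : orient a a b = 0 := by
  unfold orient; ring

theorem Plane.ext_coord {a b : Plane} (h0 : a 0 = b 0) (h1 : a 1 = b 1) : a = b := by
  ext i; fin_cases i <;> assumption

/-- No three points of `S` are on a line. -/
def GenPos (S : Finset Plane) : Prop :=
  ∀ a ∈ S, ∀ b ∈ S, ∀ c ∈ S, a ≠ b → a ≠ c → b ≠ c → orient a b c ≠ 0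

theorem GenPos.mono {S T : Finset Plane} (hS : GenPos S) (h : T ⊆ S) : GenPos T :=
  fun a ha b hb c hc => hS a (h ha) b (h hb) c (h hc)

/-- The number of points of `S` to the left of the directed line from `a` to `b`. -/
noncomputable def left (S : Finset Plane) (a b : Plane) : ℕ :=
  #{c ∈ S | 0 < orient a b c}

/-- The cross product of the vector `u` with the vector from `z` to `c`. -/
def wedge (u : ℝ × ℝ) (z c : Plane) : ℝ := u.1 * (c 1 - z 1) - u.2 * (c 0 - z 0)

theorem wedge_neg (u : ℝ × ℝ) (z c : Plane) : wedge (-u) z c = -wedge u z c := by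
  simp [wedge]; ring

open Classical in
theorem left_erase (S : Finset Plane) {p : Plane} (hp : p ∈ S) (a b : Plane) :
    left S a b = left (S.erase p) a b + if 0 < orient a b p then 1 else 0 := by
  unfold left
  conv_lhs => rw [← insert_erase hp, filter_insert]
  split_ifs with h
  · rw [card_insert_of_notMem (by simp)]
  · rfl

open Classical in
theorem left_add_left {S : Finset Plane} (hS : GenPos S) {a b : Plane} (ha : a ∈ S) (hb : b ∈ S)
    (hab : a ≠ b) : left S a b + left S b a + 2 = #S := by
  have h : left S b a = #{c ∈ (S.erase a).erase b | ¬ 0 < orient a b c} := by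
    unfold left
    congr 1
    ext c
    simp only [mem_filter, mem_erase, orient_swap a b c]
    constructor
    · rintro ⟨hc, h⟩
      refine ⟨⟨?_, ?_, hc⟩, by linarith⟩ <;> rintro rfl <;> simp at h
    · rintro ⟨⟨h1, h2, hc⟩, h⟩
      refine ⟨hc, ?_⟩
      have := hS a ha b hb c hc hab h2.symm h1.symm
      rcases lt_trichotomy (orient a b c) 0 with h' | h' | h' <;> [linarith; simp_all; simp_all]
  have h' : left S a b = #{c ∈ (S.erase a).erase b | 0 < orient a b c} := by
    unfold left
    congr 1
    ext c
    simp only [mem_filter, mem_erase]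
    constructor
    · rintro ⟨hc, h⟩
      refine ⟨⟨?_, ?_, hc⟩, h⟩ <;> rintro rfl <;> simp at h
    · rintro ⟨⟨h1, h2, hc⟩, h⟩
      exact ⟨hc, h⟩
  rw [h, h', card_filter_add_card_filter_not, card_erase_of_mem (by simp [hb, hab.symm]),
    card_erase_of_mem ha]
  have : 1 < #S := one_lt_card.2 ⟨a, ha, b, hb, hab⟩
  omega

open Classical in
/-- Rotating a line about the point `z` of `S`. -/
theorem pivot {S : Finset Plane} (hS : GenPos S) {z : Plane} (hz : z ∈ S) (u : ℝ × ℝ)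
    (hu : ∀ c ∈ S.erase z, wedge u z c ≠ 0) (K : ℕ) :
    #{b ∈ S.erase z | wedge u z b < 0 ∧ left S b z = K} +
        (if K < #{b ∈ S.erase z | 0 < wedge u z b} then 1 else 0) =
      #{b ∈ S.erase z | 0 < wedge u z b ∧ left S z b = K} +
        (if K < #{b ∈ S.erase z | wedge u z b < 0} then 1 else 0) := by
  -- The cotangent of the angle from `u` to `c - z`, which orders the lines through `z` as they are
  -- met in a half turn.
  set f : Plane → ℝ := fun c => (u.1 * (c 0 - z 0) + u.2 * (c 1 - z 1)) / wedge u z c with hfdef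
  have key : ∀ b ∈ S.erase z, ∀ c ∈ S.erase z, (u.1 ^ 2 + u.2 ^ 2) * orient z b c =
      wedge u z b * wedge u z c * (f b - f c) := by
    intro b hb c hc
    have h1 := hu b hb
    have h2 := hu c hc
    simp only [hfdef]
    field_simp
    unfold wedge orient
    ring
  have hpos : (S.erase z).Nonempty → 0 < u.1 ^ 2 + u.2 ^ 2 := by
    rintro ⟨c, hc⟩
    have := hu c hc
    by_contra h
    have h1 : u.1 = 0 := by nlinarith [sq_nonneg u.1, sq_nonneg u.2]
    have h2 : u.2 = 0 := by nlinarith [sq_nonneg u.1, sq_nonneg u.2]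
    exact this (by simp [wedge, h1, h2])
  have hinj : Set.InjOn f (S.erase z : Finset Plane) := by
    intro b hb c hc hbc
    by_contra hne
    have hb' := mem_erase.1 hb
    have hc' := mem_erase.1 hc
    have h := key b hb c hc
    rw [hbc, sub_self, mul_zero] at h
    rcases mul_eq_zero.1 h with h | h
    · exact (hpos ⟨b, hb⟩).ne' h
    · exact hS z hz b hb'.2 c hc'.2 hb'.1.symm hc'.1.symm hne h
  have main := level_crossing (S.erase z) f (fun c => wedge u z c < 0) hinj K
  have hneg : ∀ b ∈ S.erase z, (¬ wedge u z b < 0 ↔ 0 < wedge u z b) := fun b hb =>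
    ⟨fun h => lt_of_le_of_ne (not_lt.1 h) (hu b hb).symm, fun h => h.not_gt⟩
  have e1 : #{b ∈ S.erase z | ¬ wedge u z b < 0} = #{b ∈ S.erase z | 0 < wedge u z b} :=
    congrArg card (filter_congr hneg)
  -- The mixed rank is the left count of the rotating line when it meets `b`, directed from `b` to
  -- `z` or from `z` to `b` according to the side of `u` on which `b` lies.
  have rank : ∀ b ∈ S.erase z, mixedRank (S.erase z) f (fun c => wedge u z c < 0) b =
      #{c ∈ S.erase z | 0 < wedge u z b * orient z b c} := by
    intro b hb
    unfold mixedRank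
    rw [← card_union_of_disjoint
      (disjoint_filter.2 fun x _ h h' => h'.1 h.1), ← filter_or]
    refine congrArg card (filter_congr fun c hc => ?_)
    have h := key b hb c hc
    have hp := hpos ⟨b, hb⟩
    have hb0 := hu b hb
    have hsq : 0 < wedge u z b ^ 2 := by positivity
    have h3 : (u.1 ^ 2 + u.2 ^ 2) * (wedge u z b * orient z b c) =
        wedge u z b ^ 2 * (wedge u z c * (f b - f c)) := by linear_combination wedge u z b * h
    have h4 : 0 < wedge u z b * orient z b c ↔ 0 < wedge u z c * (f b - f c) := by
      rw [← mul_pos_iff_of_pos_left hp, h3, mul_pos_iff_of_pos_left hsq]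
    rw [h4, hneg c hc]
    rcases lt_or_gt_of_ne (hu c hc) with h5 | h5
    · simp [h5, h5.not_gt, mul_pos_iff]
    · simp [h5, h5.not_gt]
  have fl : ∀ b ∈ S.erase z, wedge u z b < 0 →
      mixedRank (S.erase z) f (fun c => wedge u z c < 0) b = left S b z := by
    intro b hb hw
    rw [rank b hb]
    unfold left
    congr 1
    ext c
    simp only [mem_filter, mem_erase, orient_swap z b c, mul_pos_iff, hw, hw.not_gt]
    constructor
    · rintro ⟨⟨_, hc⟩, h⟩
      exact ⟨hc, by simpa using h⟩
    · rintro ⟨hc, h⟩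
      refine ⟨⟨?_, hc⟩, by simpa using h⟩
      rintro rfl
      simp at h
  have fr : ∀ b ∈ S.erase z, 0 < wedge u z b →
      mixedRank (S.erase z) f (fun c => wedge u z c < 0) b = left S z b := by
    intro b hb hw
    rw [rank b hb]
    unfold left
    congr 1
    ext c
    simp only [mem_filter, mem_erase, mul_pos_iff, hw, hw.not_gt]
    constructor
    · rintro ⟨⟨_, hc⟩, h⟩
      exact ⟨hc, by simpa using h⟩
    · rintro ⟨hc, h⟩
      refine ⟨⟨?_, hc⟩, by simpa using h⟩
      rintro rfl
      simp at h
  have e2 : #{b ∈ S.erase z | wedge u z b < 0 ∧ left S b z = K} =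
      #{b ∈ S.erase z | wedge u z b < 0 ∧
        mixedRank (S.erase z) f (fun c => wedge u z c < 0) b = K} :=
    congrArg card (filter_congr fun b hb => and_congr_right fun h => by rw [fl b hb h])
  have e3 : #{b ∈ S.erase z | 0 < wedge u z b ∧ left S z b = K} =
      #{b ∈ S.erase z | ¬ wedge u z b < 0 ∧
        mixedRank (S.erase z) f (fun c => wedge u z c < 0) b = K} :=
    congrArg card (filter_congr fun b hb => by
      rw [hneg b hb]
      exact and_congr_right fun h => by rw [fr b hb h])
  rw [e1] at main
  rw [e2, e3]
  exact main

end Orientation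

/-! ### Lower bounds for the number of directed pairs with few points on the left. -/

section LeftCounts

-- A full turn about `z` brings the left count back to its start, so it passes each level equally
-- often upwards and downwards.
open scoped Classical in
theorem card_in_eq_card_out {S : Finset Plane} (hS : GenPos S) {z : Plane} (hz : z ∈ S) (K : ℕ) :
    #{b ∈ S.erase z | left S b z = K} = #{b ∈ S.erase z | left S z b = K} := by
  -- A starting direction whose slope is that of no line through `z` and another point.
  obtain ⟨t, ht⟩ := ((S.erase z).image fun c => (c 1 - z 1) / (c 0 - z 0)).exists_notMem
  have hu : ∀ c ∈ S.erase z, wedge (1, t) z c ≠ 0 := by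
    intro c hc h
    simp only [wedge, one_mul] at h
    by_cases h0 : c 0 - z 0 = 0
    · have h1 : c 1 - z 1 = 0 := by rw [h0] at h; linarith
      exact (mem_erase.1 hc).1 (Plane.ext_coord (by linarith) (by linarith))
    · refine ht (mem_image.2 ⟨c, hc, ?_⟩)
      rw [div_eq_iff h0]
      linarith
  -- The two half turns, from `u` and from `-u`, have opposite boundary terms, which cancel.
  have h1 := pivot hS hz (1, t) hu K
  have h2 := pivot hS hz (-(1, t)) (fun c hc => by
    rw [wedge_neg]; exact neg_ne_zero.2 (hu c hc)) K
  simp only [wedge_neg, neg_neg_iff_pos, neg_pos] at h2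
  have split : ∀ (P : Plane → Prop) [DecidablePred P], #{b ∈ S.erase z | P b} =
      #{b ∈ S.erase z | wedge (1, t) z b < 0 ∧ P b} +
        #{b ∈ S.erase z | 0 < wedge (1, t) z b ∧ P b} := by
    intro P _
    rw [← card_union_of_disjoint
      (disjoint_filter.2 fun x _ h h' => h.1.not_gt h'.1), ← filter_or]
    refine congrArg card (filter_congr fun c hc => ?_)
    rcases lt_or_gt_of_ne (hu c hc) with h | h <;> simp [h, h.not_gt]
  rw [split fun b => left S b z = K, split fun b => left S z b = K]
  omega

/-- `p` is a vertex of the convex hull of `S`. -/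
def Extreme (S : Finset Plane) (p : Plane) : Prop :=
  ∃ u : ℝ × ℝ, ∀ c ∈ S, c ≠ p → 0 < wedge u p c

-- Start the rotation at a supporting direction: all other points are on one side, so the left count
-- runs monotonically through all values and takes each once.
open scoped Classical in
theorem Extreme.card_rank {S : Finset Plane} (hS : GenPos S) {p : Plane} (hp : p ∈ S)
    (hext : Extreme S p) {K : ℕ} (hK : K + 1 < #S) :
    #{b ∈ S.erase p | left S b p = K} = 1 ∧ #{b ∈ S.erase p | left S p b = K} = 1 := by
  obtain ⟨u, hu⟩ := hext
  have hu' : ∀ c ∈ S.erase p, 0 < wedge u p c := fun c hc =>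
    hu c (mem_erase.1 hc).2 (mem_erase.1 hc).1
  have h := pivot hS hp u (fun c hc => (hu' c hc).ne') K
  have e1 : {b ∈ S.erase p | wedge u p b < 0 ∧ left S b p = K} = ∅ :=
    filter_false_of_mem fun c hc h => (hu' c hc).not_gt h.1
  have e2 : {b ∈ S.erase p | wedge u p b < 0} = ∅ :=
    filter_false_of_mem fun c hc h => (hu' c hc).not_gt h
  have e3 : {b ∈ S.erase p | 0 < wedge u p b} = S.erase p :=
    filter_true_of_mem hu'
  have e4 : {b ∈ S.erase p | 0 < wedge u p b ∧ left S p b = K} =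
      {b ∈ S.erase p | left S p b = K} :=
    filter_congr fun c hc => and_iff_right (hu' c hc)
  rw [e1, e2, e3, e4, card_erase_of_mem hp, if_pos (by omega), card_empty, if_neg (by simp)] at h
  have := card_in_eq_card_out hS hp K
  omega

open scoped Classical in
theorem Extreme.card_rank_lt {S : Finset Plane} (hS : GenPos S) {p : Plane} (hp : p ∈ S)
    (hext : Extreme S p) {K : ℕ} (hK : K < #S) :
    #{b ∈ S.erase p | left S b p < K} = K ∧ #{b ∈ S.erase p | left S p b < K} = K := by
  induction K with
  | zero => simp
  | succ K ih =>
    have h := hext.card_rank hS hp hK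
    have ih := ih (by omega)
    have step : ∀ g : Plane → ℕ, #{b ∈ S.erase p | g b < K + 1} =
        #{b ∈ S.erase p | g b < K} + #{b ∈ S.erase p | g b = K} := by
      intro g
      rw [← card_union_of_disjoint
        (disjoint_filter.2 fun x _ h h' => by omega), ← filter_or]
      exact congrArg card (filter_congr fun c _ => by omega)
    rw [step, step]
    omega

open scoped Classical in
/-- The directed pairs with exactly `K` points on the left, and `p` on the right. -/
noncomputable def awayPairs (S : Finset Plane) (p : Plane) (K : ℕ) : Finset (Plane × Plane) :=
  {x ∈ S ×ˢ S | left S x.1 x.2 = K ∧ orient x.1 x.2 p < 0}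

-- Rotate about `a` in `S` without `p`, starting from the line through `a` and `p`: the half turn
-- selects exactly the directed pairs that have `p` on the right, and for those deleting `p` does
-- not change the left count.
open scoped Classical in
theorem awayPairs_pivot {S : Finset Plane} (hS : GenPos S) {p a : Plane} (hp : p ∈ S)
    (ha : a ∈ S) (hap : a ≠ p) (K : ℕ) :
    #{b ∈ S | (b, a) ∈ awayPairs S p K} + (if K < left S a p then 1 else 0) =
      #{b ∈ S | (a, b) ∈ awayPairs S p K} + (if K < left S p a then 1 else 0) := by
  have hw : ∀ b, wedge (p 0 - a 0, p 1 - a 1) a b = orient a p b := fun b => rfl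
  have h := pivot (hS.mono (erase_subset p S)) (mem_erase.2 ⟨hap, ha⟩)
    (p 0 - a 0, p 1 - a 1) (fun c hc => by
      simp only [mem_erase] at hc
      rw [hw]
      exact hS a ha p hp c hc.2.2 hap hc.1.symm hc.2.1.symm) K
  simp only [hw] at h
  have e1 : #{b ∈ (S.erase p).erase a | 0 < orient a p b} = left S a p := by
    unfold left
    congr 1
    ext c
    simp only [mem_filter, mem_erase]
    constructor
    · rintro ⟨⟨h1, h2, hc⟩, h⟩
      exact ⟨hc, h⟩
    · rintro ⟨hc, h⟩
      refine ⟨⟨?_, ?_, hc⟩, h⟩ <;> rintro rfl <;> simp at h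
  have e2 : #{b ∈ (S.erase p).erase a | orient a p b < 0} = left S p a := by
    unfold left
    congr 1
    ext c
    simp only [mem_filter, mem_erase, orient_swap a p c, neg_pos]
    constructor
    · rintro ⟨⟨h1, h2, hc⟩, h⟩
      exact ⟨hc, h⟩
    · rintro ⟨hc, h⟩
      refine ⟨⟨?_, ?_, hc⟩, h⟩ <;> rintro rfl <;> simp at h
  have e3 : #{b ∈ (S.erase p).erase a | orient a p b < 0 ∧ left (S.erase p) b a = K} =
      #{b ∈ S | (b, a) ∈ awayPairs S p K} := by
    congr 1
    ext b
    simp only [mem_filter, mem_erase, awayPairs, mem_product]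
    rw [left_erase S hp b a, ← orient_rotate a p b, ← orient_rotate p b a]
    constructor
    · rintro ⟨⟨h1, h2, hb⟩, h3, h4⟩
      exact ⟨hb, ⟨hb, ha⟩, by simp [h3.not_gt, h4], h3⟩
    · rintro ⟨hb, -, h3, h4⟩
      refine ⟨⟨?_, ?_, hb⟩, h4, by simpa [h4.not_gt] using h3⟩ <;> rintro rfl <;> simp at h4
  have e4 : #{b ∈ (S.erase p).erase a | 0 < orient a p b ∧ left (S.erase p) a b = K} =
      #{b ∈ S | (a, b) ∈ awayPairs S p K} := by
    congr 1
    ext b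
    simp only [mem_filter, mem_erase, awayPairs, mem_product]
    have ho : orient a p b = -orient a b p := by
      rw [← orient_swap, orient_rotate]
    rw [left_erase S hp a b, ho, neg_pos]
    constructor
    · rintro ⟨⟨h1, h2, hb⟩, h3, h4⟩
      exact ⟨hb, ⟨ha, hb⟩, by simp [h3.not_gt, h4], h3⟩
    · rintro ⟨hb, -, h3, h4⟩
      refine ⟨⟨?_, ?_, hb⟩, h4, by simpa [h4.not_gt] using h3⟩ <;> rintro rfl <;> simp at h4
  rw [e1, e2, e3, e4] at h
  exact h

open scoped Classical in
theorem card_awayPairs (S : Finset Plane) {p : Plane} (hp : p ∈ S) (K : ℕ) :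
    #(awayPairs S p K) = ∑ a ∈ S.erase p, #{b ∈ S | (b, a) ∈ awayPairs S p K} := by
  rw [card_eq_sum_card_fiberwise (f := Prod.snd) (t := S.erase p)]
  · refine sum_congr rfl fun a ha => ?_
    refine card_bij' (fun x _ => x.1) (fun b _ => (b, a)) ?_ ?_ ?_ ?_
    · rintro ⟨x, y⟩ h
      simp only [mem_filter] at h ⊢
      obtain ⟨h, rfl⟩ := h
      exact ⟨(mem_product.1 (mem_filter.1 h).1).1, h⟩
    · intro b h
      simpa using (mem_filter.1 h).2
    · rintro ⟨x, y⟩ h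
      simp only [mem_filter] at h
      simp [h.2]
    · intro b h
      rfl
  · rintro ⟨x, y⟩ h
    simp only [awayPairs, mem_coe, mem_filter, mem_product] at h
    simp only [mem_coe, mem_erase]
    refine ⟨?_, h.1.2⟩
    rintro rfl
    simp at h

-- If `left S a p ≤ K`, then `left S p a > K` because `2 * K + 3 ≤ #S`, and the rotation about `a`
-- yields a pair ending at `a`. As `p` is extreme, there are `K + 1` such points `a`.
open scoped Classical in
theorem card_awayPairs_ge {S : Finset Plane} (hS : GenPos S) {p : Plane} (hp : p ∈ S)
    (hext : Extreme S p) {K : ℕ} (hK : 2 * K + 3 ≤ #S) : K + 1 ≤ #(awayPairs S p K) := by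
  rw [card_awayPairs S hp, ← (hext.card_rank_lt hS hp (K := K + 1) (by omega)).1, card_filter]
  refine sum_le_sum fun a ha => ?_
  obtain ⟨hap, ha⟩ := mem_erase.1 ha
  have h1 := awayPairs_pivot hS hp ha hap K
  have h2 := left_add_left hS ha hp hap
  split_ifs at h1 ⊢ <;> omega

open scoped Classical in
/-- In the extremal case every point is in at most one of the pairs. -/
theorem awayPairs_degree_le {S : Finset Plane} (hS : GenPos S) {p : Plane} (hp : p ∈ S)
    (hext : Extreme S p) {K : ℕ} (hK : 2 * K + 3 ≤ #S) (hcard : #(awayPairs S p K) = K + 1)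
    {a : Plane} (ha : a ∈ S) :
    #{b ∈ S | (b, a) ∈ awayPairs S p K} + #{b ∈ S | (a, b) ∈ awayPairs S p K} ≤ 1 := by
  by_cases hap : a = p
  · subst hap
    simp [awayPairs]
  have hle : ∀ a ∈ S.erase p, (if left S a p < K + 1 then 1 else 0) ≤
      #{b ∈ S | (b, a) ∈ awayPairs S p K} := by
    intro a ha
    obtain ⟨hap, ha⟩ := mem_erase.1 ha
    have h1 := awayPairs_pivot hS hp ha hap K
    have h2 := left_add_left hS ha hp hap
    split_ifs at h1 ⊢ <;> omega
  -- Equality of the sums forces equality at each `a`, so the in-degree is exactly the indicator;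
  -- the rotation identity then determines the out-degree.
  have heq := (sum_eq_sum_iff_of_le hle).1 (by
    rw [← card_filter, (hext.card_rank_lt hS hp (K := K + 1) (by omega)).1,
      ← card_awayPairs S hp, hcard]) a (mem_erase.2 ⟨hap, ha⟩)
  have h1 := awayPairs_pivot hS hp ha hap K
  have h2 := left_add_left hS ha hp hap
  split_ifs at h1 heq <;> omega

/-- The number of directed pairs with fewer than `k` points on the left. -/
noncomputable def fewLeft (S : Finset Plane) (k : ℕ) : ℕ :=
  #{x ∈ S ×ˢ S | x.1 ≠ x.2 ∧ left S x.1 x.2 < k}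

-- The terms `2 * (k + 1)` are the pairs that start or end at `p`. A pair avoiding `p` either has
-- fewer than `k` other points on its left, or has exactly `k` and leaves `p` on its right.
open scoped Classical in
theorem fewLeft_succ {S : Finset Plane} (hS : GenPos S) {p : Plane} (hp : p ∈ S)
    (hext : Extreme S p) {k : ℕ} (hk : k + 1 < #S) :
    fewLeft S (k + 1) = 2 * (k + 1) + fewLeft (S.erase p) k + #(awayPairs S p k) := by
  have h := hext.card_rank_lt hS hp hk
  have e1 : #{x ∈ S ×ˢ S | (x.1 ≠ x.2 ∧ left S x.1 x.2 < k + 1) ∧ x.2 = p} = k + 1 := by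
    refine Eq.trans ?_ h.1
    refine card_bij' (fun x _ => x.1) (fun b _ => (b, p)) ?_ ?_ ?_ ?_
    · rintro ⟨x, y⟩ h
      simp only [mem_filter, mem_product] at h
      obtain ⟨h1, h2, rfl⟩ := h
      simp_all
    · intro b h
      simp_all
    · rintro ⟨x, y⟩ h
      simp_all
    · intro b h
      rfl
  have e2 : #{x ∈ S ×ˢ S | ((x.1 ≠ x.2 ∧ left S x.1 x.2 < k + 1) ∧ ¬ x.2 = p) ∧ x.1 = p} =
      k + 1 := by
    refine Eq.trans ?_ h.2
    refine card_bij' (fun x _ => x.2) (fun b _ => (p, b)) ?_ ?_ ?_ ?_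
    · rintro ⟨x, y⟩ h
      simp only [mem_filter, mem_product] at h
      obtain ⟨h1, h2, rfl⟩ := h
      simp_all
    · intro b h
      simp only [mem_filter, mem_erase, mem_product] at h ⊢
      exact ⟨⟨hp, h.1.2⟩, ⟨⟨h.1.1.symm, h.2⟩, h.1.1⟩, trivial⟩
    · rintro ⟨x, y⟩ h
      simp_all
    · intro b h
      rfl
  have e3 : {x ∈ S ×ˢ S | ((x.1 ≠ x.2 ∧ left S x.1 x.2 < k + 1) ∧ ¬ x.2 = p) ∧ ¬ x.1 = p} =
      {x ∈ S.erase p ×ˢ S.erase p | x.1 ≠ x.2 ∧ left (S.erase p) x.1 x.2 < k} ∪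
        awayPairs S p k := by
    ext ⟨x, y⟩
    simp only [mem_filter, mem_union, mem_product, mem_erase, awayPairs]
    constructor
    · rintro ⟨⟨hx, hy⟩, ⟨⟨hxy, hl⟩, hyp⟩, hxp⟩
      have h0 := hS x hx y hy p hp hxy hxp hyp
      rw [left_erase S hp] at hl
      by_cases hlt : left (S.erase p) x y < k
      · exact Or.inl ⟨⟨⟨hxp, hx⟩, hyp, hy⟩, hxy, hlt⟩
      · refine Or.inr ⟨⟨hx, hy⟩, ?_⟩
        rw [left_erase S hp]
        split_ifs at hl ⊢ with h1
        · omega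
        · exact ⟨by omega, lt_of_le_of_ne (not_lt.1 h1) h0⟩
    · rintro (⟨⟨⟨hxp, hx⟩, hyp, hy⟩, hxy, hl⟩ | ⟨⟨hx, hy⟩, hl, ho⟩)
      · refine ⟨⟨hx, hy⟩, ⟨⟨hxy, ?_⟩, hyp⟩, hxp⟩
        rw [left_erase S hp]
        split_ifs <;> omega
      · refine ⟨⟨hx, hy⟩, ⟨⟨?_, by omega⟩, ?_⟩, ?_⟩ <;> rintro rfl <;> simp at ho
  have e4 : Disjoint
      {x ∈ S.erase p ×ˢ S.erase p | x.1 ≠ x.2 ∧ left (S.erase p) x.1 x.2 < k}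
        (awayPairs S p k) := by
    rw [disjoint_left]
    rintro ⟨x, y⟩ h1 h2
    simp only [mem_filter, awayPairs] at h1 h2
    rw [left_erase S hp, if_neg h2.2.2.not_gt] at h2
    omega
  unfold fewLeft
  rw [← card_filter_add_card_filter_not (s := {x ∈ S ×ˢ S | x.1 ≠ x.2 ∧ left S x.1 x.2 < k + 1})
      (fun x => x.2 = p), filter_filter, filter_filter, e1,
    ← card_filter_add_card_filter_not (s := {x ∈ S ×ˢ S |
        (x.1 ≠ x.2 ∧ left S x.1 x.2 < k + 1) ∧ ¬ x.2 = p}) (fun x => x.1 = p),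
    filter_filter, filter_filter, e2, e3, card_union_of_disjoint e4]
  ring

/-- If some point of `S` is to the right of a line, then so is some vertex of the convex hull. -/
theorem exists_extreme_right (S : Finset Plane) (a b : Plane) {q : Plane} (hq : q ∈ S)
    (hqr : orient a b q < 0) : ∃ p ∈ S, Extreme S p ∧ orient a b p < 0 := by
  have hM : ∃ M : ℝ, 0 < M ∧ ∀ c ∈ S, c 0 ^ 2 + c 1 ^ 2 < M := by
    obtain ⟨M, hM⟩ := (S.image fun c => c 0 ^ 2 + c 1 ^ 2).bddAbove
    refine ⟨max M 0 + 1, by positivity, fun c hc => ?_⟩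
    have := hM (mem_coe.2 (mem_image_of_mem (fun c : Plane => c 0 ^ 2 + c 1 ^ 2) hc))
    have h2 := le_max_left M 0
    simp only at this
    linarith
  obtain ⟨M, hM0, hM⟩ := hM
  -- The linear term is scaled so that `q` reaches the value `M`, which no point on or to the left
  -- of the line can attain. The quadratic term makes the maximizer a strict hull vertex.
  set s : ℝ := M / (-orient a b q) with hs
  have hq' : 0 < -orient a b q := by linarith
  have hs0 : 0 < s := div_pos hM0 hq'
  obtain ⟨p, hp, hmax⟩ := S.exists_max_image
    (fun c => s * (-orient a b c) + (c 0 ^ 2 + c 1 ^ 2)) ⟨q, hq⟩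
  have hpq := hmax q hq
  have hsq : s * (-orient a b q) = M := div_mul_cancel₀ _ hq'.ne'
  -- The gradient of the maximized function at `p`, turned by a right angle.
  refine ⟨p, hp, ⟨(s * (b 0 - a 0) - 2 * p 1, s * (b 1 - a 1) + 2 * p 0), ?_⟩, ?_⟩
  · intro c hc hcp
    have h := hmax c hc
    have hpos : 0 < (c 0 - p 0) ^ 2 + (c 1 - p 1) ^ 2 := by
      by_contra hle
      exact hcp (Plane.ext_coord (by nlinarith [sq_nonneg (c 0 - p 0), sq_nonneg (c 1 - p 1)])
        (by nlinarith [sq_nonneg (c 0 - p 0), sq_nonneg (c 1 - p 1)]))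
    simp only [orient] at h
    simp only [wedge]
    nlinarith
  · by_contra hle
    have := hM p hp
    have : s * (-orient a b p) ≤ 0 := by nlinarith
    nlinarith [sq_nonneg (q 0), sq_nonneg (q 1)]

theorem exists_extreme {S : Finset Plane} (hS : S.Nonempty) : ∃ p ∈ S, Extreme S p := by
  obtain ⟨q, hq⟩ := hS
  obtain ⟨p, hp, h, -⟩ := exists_extreme_right S (!₂[0, q 1 + 1] : Plane)
    (!₂[1, q 1 + 1] : Plane) hq (by simp [orient])
  exact ⟨p, hp, h⟩

/-- Deleting a hull vertex lowers `k` by one and loses at least `2 * (k + 1) + (k + 1)` pairs, the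
increment of the bound. -/
theorem fewLeft_ge (k : ℕ) {S : Finset Plane} (hS : GenPos S) (hk : 2 * k + 1 ≤ #S) :
    3 * (k + 1).choose 2 ≤ fewLeft S k := by
  classical
  induction k generalizing S with
  | zero => simp
  | succ k ih =>
    obtain ⟨p, hp, hext⟩ := exists_extreme (S := S) (card_pos.1 (by omega))
    have h := ih (hS.mono (erase_subset p S)) (by rw [card_erase_of_mem hp]; omega)
    have h2 := card_awayPairs_ge hS hp hext (K := k) (by omega)
    rw [fewLeft_succ hS hp hext (by omega)]
    have : (k + 1 + 1).choose 2 = (k + 1) + (k + 1).choose 2 := by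
      rw [Nat.choose_succ_succ' (k + 1) 1, Nat.choose_one_right]
    omega

open scoped Classical in
theorem fewLeft_one_eq (S : Finset Plane) :
    fewLeft S 1 = #{x ∈ S ×ˢ S | x.1 ≠ x.2 ∧ left S x.1 x.2 = 0} := by
  simp [fewLeft]

open scoped Classical in
theorem fewLeft_step (S : Finset Plane) (k : ℕ) :
    fewLeft S (k + 1) = fewLeft S k + #{x ∈ S ×ˢ S | x.1 ≠ x.2 ∧ left S x.1 x.2 = k} := by
  unfold fewLeft
  rw [← card_union_of_disjoint
    (disjoint_filter.2 fun x _ h h' => by omega), ← filter_or]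
  exact congrArg card (filter_congr fun c _ => by
    rw [← and_or_left]; exact and_congr_right fun _ => by omega)

-- Each hull vertex is the start of a directed hull edge with no point on its left.
open scoped Classical in
theorem card_extreme_le {S : Finset Plane} (hS : GenPos S) (hn : 2 ≤ #S) :
    #{p ∈ S | Extreme S p} ≤ fewLeft S 1 := by
  have h : ∀ p ∈ {p ∈ S | Extreme S p}, ∃ q, q ∈ S ∧ p ≠ q ∧ left S p q = 0 := by
    intro p hp
    obtain ⟨hp, hext⟩ := mem_filter.1 hp
    have := (hext.card_rank hS hp (K := 0) (by omega)).2
    obtain ⟨q, hq⟩ := card_pos.1 (this ▸ Nat.one_pos)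
    simp only [mem_filter, mem_erase] at hq
    exact ⟨q, hq.1.2, hq.1.1.symm, hq.2⟩
  choose! g hg using h
  rw [fewLeft_one_eq]
  refine card_le_card_of_injOn (fun p => (p, g p)) ?_ ?_
  · intro p hp
    have := hg p hp
    have hp' := (mem_filter.1 hp).1
    simp [this, hp']
  · intro p _ q _ h
    exact congrArg Prod.fst h

/-- Beyond one third of the points the lower bounds are not simultaneously sharp. -/
theorem exists_fewLeft_gt {S : Finset Plane} (hS : GenPos S) {K : ℕ} (hK : 2 * K + 3 ≤ #S)
    (hK3 : #S < 3 * (K + 1)) :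
    ∃ k ≤ K + 1, 1 ≤ k ∧ 3 * (k + 1).choose 2 < fewLeft S k := by
  classical
  by_contra hcon
  push Not at hcon
  have heq : ∀ k ≤ K + 1, fewLeft S k = 3 * (k + 1).choose 2 := fun k hk => by
    rcases Nat.eq_zero_or_pos k with rfl | h0
    · simp [fewLeft]
    · exact le_antisymm (hcon k hk h0) (fewLeft_ge k hS (by omega))
  have hch : (K + 1 + 1).choose 2 = (K + 1) + (K + 1).choose 2 := by
    rw [Nat.choose_succ_succ' (K + 1) 1, Nat.choose_one_right]
  have hH : #{p ∈ S | Extreme S p} ≤ 3 := by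
    refine (card_extreme_le hS (by omega)).trans ?_
    rw [heq 1 (by omega)]
    simp
  have haway : ∀ p ∈ {p ∈ S | Extreme S p}, #(awayPairs S p K) = K + 1 := by
    intro p hp
    obtain ⟨hp, hext⟩ := mem_filter.1 hp
    have h1 := fewLeft_succ hS hp hext (k := K) (by omega)
    have h2 := card_awayPairs_ge hS hp hext (K := K) (by omega)
    have h3 := fewLeft_ge K (hS.mono (erase_subset p S)) (by rw [card_erase_of_mem hp]; omega)
    have h4 := heq (K + 1) le_rfl
    omega
  have hright : ∀ x ∈ S, ∀ y ∈ S, x ≠ y → left S x y = K →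
      ∃ p ∈ {p ∈ S | Extreme S p}, (x, y) ∈ awayPairs S p K := by
    intro x hx y hy hxy hl
    have h1 := left_add_left hS hx hy hxy
    obtain ⟨q, hq⟩ := card_pos.1 (show 0 < left S y x by omega)
    simp only [mem_filter, orient_swap x y q, neg_pos] at hq
    obtain ⟨p, hp, hext, ho⟩ := exists_extreme_right S x y hq.1 hq.2
    exact ⟨p, by simp [hp, hext], by simp [awayPairs, hx, hy, hl, ho]⟩
  -- Each of the at most three hull vertices contributes at most 1 to in-degree plus out-degree at
  -- `z`; the two are equal, so each is at most 1.
  have hdeg : ∀ z ∈ S, #{b ∈ S.erase z | left S b z = K} ≤ 1 := by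
    intro z hz
    have h1 : #{b ∈ S.erase z | left S b z = K} ≤
        ∑ p ∈ {p ∈ S | Extreme S p}, #{b ∈ S | (b, z) ∈ awayPairs S p K} := by
      refine (card_le_card fun b hb => ?_).trans card_biUnion_le
      simp only [mem_filter, mem_erase] at hb
      obtain ⟨p, hp, h⟩ := hright b hb.1.2 z hz hb.1.1 hb.2
      exact mem_biUnion.2 ⟨p, hp, by simp [h, hb.1.2]⟩
    have h2 : #{b ∈ S.erase z | left S z b = K} ≤
        ∑ p ∈ {p ∈ S | Extreme S p}, #{b ∈ S | (z, b) ∈ awayPairs S p K} := by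
      refine (card_le_card fun b hb => ?_).trans card_biUnion_le
      simp only [mem_filter, mem_erase] at hb
      obtain ⟨p, hp, h⟩ := hright z hz b hb.1.2 hb.1.1.symm hb.2
      exact mem_biUnion.2 ⟨p, hp, by simp [h, hb.1.2]⟩
    have h3 : ∑ p ∈ {p ∈ S | Extreme S p}, (#{b ∈ S | (b, z) ∈ awayPairs S p K} +
        #{b ∈ S | (z, b) ∈ awayPairs S p K}) ≤ #{p ∈ S | Extreme S p} * 1 := by
      refine sum_le_card_nsmul _ _ _ fun p hp => ?_
      obtain ⟨hp', hext⟩ := mem_filter.1 hp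
      exact awayPairs_degree_le hS hp' hext hK (haway p hp) hz
    rw [sum_add_distrib] at h3
    have h4 := card_in_eq_card_out hS hz K
    omega
  have hsum : #{x ∈ S ×ˢ S | x.1 ≠ x.2 ∧ left S x.1 x.2 = K} ≤ #S * 1 := by
    rw [card_eq_sum_card_fiberwise (f := Prod.snd) (t := S)
      (fun x hx => (mem_product.1 (mem_filter.1 hx).1).2)]
    refine sum_le_card_nsmul _ _ _ fun z hz => (le_trans ?_ (hdeg z hz))
    refine card_le_card_of_injOn Prod.fst ?_ ?_
    · rintro ⟨x, y⟩ h
      simp only [mem_coe, mem_filter, mem_product, mem_erase] at h ⊢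
      obtain ⟨⟨⟨h1, h2⟩, h3, h4⟩, rfl⟩ := h
      exact ⟨⟨h3, h1⟩, h4⟩
    · rintro ⟨x, y⟩ h ⟨x', y'⟩ h' hxx
      simp only [mem_coe, mem_filter] at h h'
      simp_all
  -- Sharpness at `K` and `K + 1` makes the level-`K` count `3 * (K + 1)`, which exceeds `#S`.
  have h1 := fewLeft_step S K
  rw [heq K (by omega), heq (K + 1) le_rfl] at h1
  omega

end LeftCounts

/-! ### Double counting separations by pairs and by quadruples. -/

section Quadruples

variable {n : ℕ}

/-- The sum of `f` over all quadruples. -/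
def sumQuad (f : Fin n → Fin n → Fin n → Fin n → ℕ) : ℕ :=
  ∑ a, ∑ b, ∑ c, ∑ d, f a b c d

theorem sumQuad_swap12 (f : Fin n → Fin n → Fin n → Fin n → ℕ) :
    sumQuad f = sumQuad fun a b c d => f b a c d :=
  sum_comm

theorem sumQuad_swap23 (f : Fin n → Fin n → Fin n → Fin n → ℕ) :
    sumQuad f = sumQuad fun a b c d => f a c b d :=
  sum_congr rfl fun _ _ => sum_comm

theorem sumQuad_swap34 (f : Fin n → Fin n → Fin n → Fin n → ℕ) :
    sumQuad f = sumQuad fun a b c d => f a b d c :=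
  sum_congr rfl fun _ _ => sum_congr rfl fun _ _ => sum_comm

theorem sumQuad_add (f g : Fin n → Fin n → Fin n → Fin n → ℕ) :
    (sumQuad fun a b c d => f a b c d + g a b c d) = sumQuad f + sumQuad g := by
  simp only [sumQuad, sum_add_distrib]

/-- A sum over pairs of disjoint pairs, grouped by their union. -/
theorem sumQuad_eq_sorted (f : Fin n → Fin n → Fin n → Fin n → ℕ) :
    (sumQuad fun i j w x =>
      if i < j ∧ w < x ∧ i ≠ w ∧ i ≠ x ∧ j ≠ w ∧ j ≠ x then f i j w x else 0) =
    sumQuad fun a b c d => if a < b ∧ b < c ∧ c < d then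
      f a b c d + f a c b d + f a d b c + f b c a d + f b d a c + f c d a b else 0 := by
  -- The six ways in which two disjoint increasing pairs can interleave; each is then relabelled to
  -- increasing order.
  have e : (fun i j w x : Fin n =>
      if i < j ∧ w < x ∧ i ≠ w ∧ i ≠ x ∧ j ≠ w ∧ j ≠ x then f i j w x else 0) =
      fun i j w x => (if i < j ∧ j < w ∧ w < x then f i j w x else 0) +
        (if i < w ∧ w < j ∧ j < x then f i j w x else 0) +
        (if i < w ∧ w < x ∧ x < j then f i j w x else 0) +
        (if w < i ∧ i < j ∧ j < x then f i j w x else 0) +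
        (if w < i ∧ i < x ∧ x < j then f i j w x else 0) +
        (if w < x ∧ x < i ∧ i < j then f i j w x else 0) := by
    funext i j w x
    split_ifs <;> omega
  rw [e]
  simp only [sumQuad_add]
  rw [sumQuad_swap23 fun i j w x => if i < w ∧ w < j ∧ j < x then f i j w x else 0,
    sumQuad_swap23 fun i j w x => if i < w ∧ w < x ∧ x < j then f i j w x else 0,
    sumQuad_swap34 fun a b c d => if a < b ∧ b < d ∧ d < c then f a c b d else 0,
    sumQuad_swap23 fun i j w x => if w < i ∧ i < j ∧ j < x then f i j w x else 0,
    sumQuad_swap12 fun a b c d => if b < a ∧ a < c ∧ c < d then f a c b d else 0,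
    sumQuad_swap23 fun i j w x => if w < i ∧ i < x ∧ x < j then f i j w x else 0,
    sumQuad_swap12 fun a b c d => if b < a ∧ a < d ∧ d < c then f a c b d else 0,
    sumQuad_swap34 fun a b c d => if a < b ∧ b < d ∧ d < c then f b c a d else 0,
    sumQuad_swap23 fun i j w x => if w < x ∧ x < i ∧ i < j then f i j w x else 0,
    sumQuad_swap12 fun a b c d => if b < d ∧ d < a ∧ a < c then f a c b d else 0,
    sumQuad_swap34 fun a b c d => if a < d ∧ d < b ∧ b < c then f b c a d else 0,
    sumQuad_swap23 fun a b c d => if a < c ∧ c < b ∧ b < d then f b d a c else 0]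
  simp only [← sumQuad_add]
  congr 1
  funext a b c d
  split_ifs <;> rfl

variable (side : Fin n → Fin n → Fin n → Bool)

/-- The number of points on the first side of `i j`. -/
def sideCount (i j : Fin n) : ℕ := #{w | w ≠ i ∧ w ≠ j ∧ side i j w = true}

/-- The number of points on the second side of `i j`. -/
def otherCount (i j : Fin n) : ℕ := #{w | w ≠ i ∧ w ≠ j ∧ side i j w = false}

/-- `1` if `i j` separates `w` from `x`, and `0` otherwise. -/
def sep (i j w x : Fin n) : ℕ := if side i j w = side i j x then 0 else 1

/-- The number of pairs from the quadruple that separate the other two. -/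
def sixSep (a b c d : Fin n) : ℕ :=
  sep side a b c d + sep side a c b d + sep side a d b c + sep side b c a d +
    sep side b d a c + sep side c d a b

theorem sideCount_add_otherCount {i j : Fin n} (h : i ≠ j) :
    sideCount side i j + otherCount side i j + 2 = n := by
  unfold sideCount otherCount
  have e : ∀ b : Bool, ({w | w ≠ i ∧ w ≠ j ∧ side i j w = b} : Finset (Fin n)) =
      {w ∈ (univ.erase i).erase j | side i j w = b} := by
    intro b
    ext w
    simp only [mem_filter, mem_univ, mem_erase, true_and]
    tauto
  have e' : {w ∈ (univ.erase i).erase j | side i j w = false} =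
      {w ∈ (univ.erase i).erase j | ¬ side i j w = true} := by simp
  rw [e, e, e', card_filter_add_card_filter_not, card_erase_of_mem (by simp [h.symm]),
    card_erase_of_mem (mem_univ i), card_univ, Fintype.card_fin]
  have := i.2
  have := j.2
  have : (i : ℕ) ≠ j := fun h' => h (Fin.ext h')
  omega

theorem sideCount_mul_otherCount (i j : Fin n) :
    sideCount side i j * otherCount side i j =
      ∑ w, ∑ x, if w < x ∧ i ≠ w ∧ i ≠ x ∧ j ≠ w ∧ j ≠ x then sep side i j w x else 0 := by
  set g : Fin n → Fin n → ℕ := fun w x =>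
    if (w ≠ i ∧ w ≠ j ∧ side i j w = true) ∧ (x ≠ i ∧ x ≠ j ∧ side i j x = false) then 1 else 0
  have h1 : sideCount side i j * otherCount side i j = ∑ w, ∑ x, g w x := by
    unfold sideCount otherCount
    rw [card_filter, card_filter, sum_mul_sum]
    refine sum_congr rfl fun w _ => sum_congr rfl fun x _ => ?_
    simp only [g, ite_and, mul_ite, mul_one, mul_zero]
    split_ifs <;> rfl
  have h2 : ∑ w, ∑ x, g w x =
      ∑ w, ∑ x, (if w < x then g w x else 0) + ∑ w, ∑ x, (if x < w then g w x else 0) := by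
    simp only [← sum_add_distrib]
    refine sum_congr rfl fun w _ => sum_congr rfl fun x _ => ?_
    rcases lt_trichotomy w x with h | h | h
    · simp [h, h.not_gt]
    · subst h
      simp [g]
      tauto
    · simp [h, h.not_gt]
  rw [h1, h2, sum_comm (f := fun w x => if x < w then g w x else 0)]
  simp only [← sum_add_distrib]
  refine sum_congr rfl fun w _ => sum_congr rfl fun x _ => ?_
  simp only [g, sep]
  by_cases hwx : w < x
  · by_cases hd : i ≠ w ∧ i ≠ x ∧ j ≠ w ∧ j ≠ x
    · obtain ⟨h1, h2, h3, h4⟩ := hd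
      cases hw : side i j w <;> cases hx : side i j x <;>
        simp [hwx, h1, h2, h3, h4, h1.symm, h2.symm, h3.symm, h4.symm]
    · have hd' : ¬ (w < x ∧ i ≠ w ∧ i ≠ x ∧ j ≠ w ∧ j ≠ x) := fun h => hd h.2
      rw [if_neg hd', if_pos hwx, if_pos hwx, if_neg, if_neg]
      · rintro ⟨⟨h1, h2, -⟩, h3, h4, -⟩
        exact hd ⟨h3.symm, h1.symm, h4.symm, h2.symm⟩
      · rintro ⟨⟨h1, h2, -⟩, h3, h4, -⟩
        exact hd ⟨h1.symm, h3.symm, h2.symm, h4.symm⟩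
  · simp [hwx]

/-- Counting separations by pairs and by quadruples. -/
theorem sum_sixSep : (sumQuad fun a b c d => if a < b ∧ b < c ∧ c < d then
      sixSep side a b c d else 0) =
    ∑ i, ∑ j, if i < j then sideCount side i j * otherCount side i j else 0 := by
  unfold sixSep
  rw [← sumQuad_eq_sorted (sep side)]
  refine sum_congr rfl fun i _ => sum_congr rfl fun j _ => ?_
  split_ifs with h
  · simp only [h, true_and]
    exact (sideCount_mul_otherCount side i j).symm
  · simp [h]

theorem sum_range_sub_two_mul {N m : ℕ} (h : 2 * m ≤ N) :
    ∑ t ∈ range m, (N - 1 - 2 * t) = m * (N - m) := by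
  induction m with
  | zero => simp
  | succ m ih =>
    rw [sum_range_succ, ih (by omega)]
    obtain ⟨e, rfl⟩ := Nat.exists_eq_add_of_le h
    have h1 : 2 * (m + 1) + e - m = m + 2 + e := by omega
    have h2 : 2 * (m + 1) + e - 1 - 2 * m = e + 1 := by omega
    have h3 : 2 * (m + 1) + e - (m + 1) = m + 1 + e := by omega
    rw [h1, h2, h3]
    ring

/-- With μ the smaller factor, the product is μ(n − 2 − μ), the sum of the weights below μ. All
weights in the range are positive, so the truncated subtraction is exact. -/
theorem mul_eq_sum_min {L R m : ℕ} (hn : L + R + 2 = n) (hm : m = n / 2 - 1) :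
    L * R = ∑ t ∈ range m, if t < L ∧ t < R then n - 3 - 2 * t else 0 := by
  have main : ∀ a b : ℕ, a ≤ b → a + b + 2 = n →
      ∑ t ∈ range m, (if t < a ∧ t < b then n - 3 - 2 * t else 0) = a * b := by
    intro a b hab hn
    have h1 : ∑ t ∈ range m, (if t < a ∧ t < b then n - 3 - 2 * t else 0) =
        ∑ t ∈ range a, (n - 2 - 1 - 2 * t) := by
      rw [← sum_filter]
      refine sum_congr ?_ fun t _ => by omega
      ext t
      simp only [mem_filter, mem_range]
      omega
    rw [h1, sum_range_sub_two_mul (by omega)]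
    congr 1
    omega
  rcases le_total L R with h | h
  · exact (main L R h hn).symm
  · rw [mul_comm, ← main R L h (by omega)]
    exact sum_congr rfl fun t _ => by simp only [and_comm]

/-- The number of pairs with more than `t` points on both sides. -/
def deepPairs (t : ℕ) : ℕ :=
  #{x : Fin n × Fin n | x.1 < x.2 ∧ t < sideCount side x.1 x.2 ∧ t < otherCount side x.1 x.2}

/-- The number of pairs with at most `t` points on one of the sides. -/
def shallowPairs (t : ℕ) : ℕ :=
  #{x : Fin n × Fin n | x.1 < x.2 ∧ (sideCount side x.1 x.2 ≤ t ∨ otherCount side x.1 x.2 ≤ t)}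

theorem deepPairs_add_shallowPairs (t : ℕ) :
    deepPairs side t + shallowPairs side t = #{x : Fin n × Fin n | x.1 < x.2} := by
  unfold deepPairs shallowPairs
  rw [← card_union_of_disjoint
    (disjoint_filter.2 fun x _ h h' => by omega), ← filter_or]
  exact congrArg card (filter_congr fun x _ => by omega)

theorem sum_sixSep_eq_sum_deepPairs : (sumQuad fun a b c d => if a < b ∧ b < c ∧ c < d then
      sixSep side a b c d else 0) =
    ∑ t ∈ range (n / 2 - 1), (n - 3 - 2 * t) * deepPairs side t := by
  rw [sum_sixSep]
  have h : ∀ i j : Fin n, (if i < j then sideCount side i j * otherCount side i j else 0) =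
      ∑ t ∈ range (n / 2 - 1), (n - 3 - 2 * t) *
        if i < j ∧ t < sideCount side i j ∧ t < otherCount side i j then 1 else 0 := by
    intro i j
    split_ifs with h
    · rw [mul_eq_sum_min (sideCount_add_otherCount side h.ne) rfl]
      refine sum_congr rfl fun t _ => ?_
      simp [h]
    · simp [h]
  simp only [h]
  rw [← Fintype.sum_prod_type', sum_comm]
  refine sum_congr rfl fun t _ => ?_
  rw [← mul_sum, deepPairs, card_filter]

end Quadruples

/-! ### Combinatorics of the two-page drawing. -/

section TwoPage

/-- The page of an edge whose ends have sum `s`, in the two-page drawing of the complete graph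
on `n` vertices whose pages are blocks of parallel chords. -/
def pageUp (n s : ℕ) : Bool := decide (s < n / 2 ∨ (n ≤ s ∧ s < n + n / 2))

/-- The side of the edge `i j` on which `w` lies, where `i < j`. -/
def pageSide (n i j w : ℕ) : Bool :=
  if w < i then pageUp n (w + j) else if w < j then !pageUp n (i + j) else pageUp n (i + w)

/-- `pageSide` encodes an orientation of each triangle, given by the page of its longest edge. Among
four vertices in line order only `a c` and `b d` interleave, and they cross exactly when they share
a page. -/
theorem pageSide_sixSep {n : ℕ} {a b c d : Fin n} (hab : a < b) (hbc : b < c) (hcd : c < d) :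
    (if pageUp n (a + c) = pageUp n (b + d) then 1 else 0) +
      sixSep (fun i j w : Fin n => pageSide n i j w) a b c d = 3 := by
  have hab : (a : ℕ) < b := hab
  have hbc : (b : ℕ) < c := hbc
  have hcd : (c : ℕ) < d := hcd
  have hac := hab.trans hbc
  have hbd := hbc.trans hcd
  have had := hac.trans hcd
  simp only [sixSep, sep, pageSide, hab, hbc, hcd, hac, hbd, had, hab.not_gt, hbc.not_gt,
    hcd.not_gt, hac.not_gt, hbd.not_gt, had.not_gt, if_true, if_false]
  cases pageUp n (a + c) <;> cases pageUp n (b + d) <;> cases pageUp n (a + d) <;> simp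

/-- The number of vertices `w` with `pageSide n i j w = s`. -/
def pageCount (n i j : ℕ) (s : Bool) : ℕ := #{w ∈ range n | w ≠ i ∧ w ≠ j ∧ pageSide n i j w = s}

theorem card_filter_fin {n : ℕ} (P : ℕ → Prop) [DecidablePred P] :
    #{w : Fin n | P w} = #{w ∈ range n | P w} := by
  rw [card_filter, card_filter, Fin.sum_univ_eq_sum_range (fun w => if P w then 1 else 0)]

theorem sideCount_pageSide {n : ℕ} (i j : Fin n) :
    sideCount (fun i j w : Fin n => pageSide n i j w) i j = pageCount n i j true := by
  unfold sideCount pageCount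
  rw [← card_filter_fin]
  simp only [ne_eq, Fin.ext_iff]

theorem otherCount_pageSide {n : ℕ} (i j : Fin n) :
    otherCount (fun i j w : Fin n => pageSide n i j w) i j = pageCount n i j false := by
  unfold otherCount pageCount
  rw [← card_filter_fin]
  simp only [ne_eq, Fin.ext_iff]

theorem card_Ico_union₃ {a b c d e f : ℕ} (hbc : b ≤ c) (hcd : c ≤ d) (hde : d ≤ e) :
    #(Ico a b ∪ Ico c d ∪ Ico e f) = (b - a) + (d - c) + (f - e) := by
  rw [card_union_of_disjoint, card_union_of_disjoint]
  · simp
  all_goals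
    rw [disjoint_left]
    intro x
    simp only [mem_union, mem_Ico]
    omega

theorem pageCount_eq {n i j : ℕ} {s : Bool} {a b c d e f : ℕ} (hbc : b ≤ c)
    (hcd : c ≤ d) (hde : d ≤ e)
    (h : ∀ w, (w < n ∧ w ≠ i ∧ w ≠ j ∧ pageSide n i j w = s) ↔
      (a ≤ w ∧ w < b) ∨ (c ≤ w ∧ w < d) ∨ (e ≤ w ∧ w < f)) :
    pageCount n i j s = (b - a) + (d - c) + (f - e) := by
  rw [← card_Ico_union₃ hbc hcd hde]
  unfold pageCount
  congr 1
  ext w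
  simp only [mem_filter, mem_range, mem_union, mem_Ico, h w, or_assoc]

theorem pageSide_eq_true {n i j w : ℕ} : pageSide n i j w = true ↔
    (w < i ∧ (w + j < n / 2 ∨ (n ≤ w + j ∧ w + j < n + n / 2))) ∨
    (i ≤ w ∧ w < j ∧ ¬ (i + j < n / 2 ∨ (n ≤ i + j ∧ i + j < n + n / 2))) ∨
    (i ≤ w ∧ j ≤ w ∧ (i + w < n / 2 ∨ (n ≤ i + w ∧ i + w < n + n / 2))) := by
  unfold pageSide pageUp
  split_ifs <;> simp <;> omega

theorem pageSide_eq_false {n i j w : ℕ} : pageSide n i j w = false ↔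
    (w < i ∧ ¬ (w + j < n / 2 ∨ (n ≤ w + j ∧ w + j < n + n / 2))) ∨
    (i ≤ w ∧ w < j ∧ (i + j < n / 2 ∨ (n ≤ i + j ∧ i + j < n + n / 2))) ∨
    (i ≤ w ∧ j ≤ w ∧ ¬ (i + w < n / 2 ∨ (n ≤ i + w ∧ i + w < n + n / 2))) := by
  unfold pageSide pageUp
  split_ifs <;> simp <;> omega

theorem pageCount_low_up {n i j : ℕ} (hij : i < j) (h : i + j < n / 2) :
    pageCount n i j true + (j - i) + 1 = n / 2 := by
  rw [pageCount_eq (a := 0) (b := i) (c := j + 1) (d := n / 2 - i) (e := n - i) (f := n)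
    (by omega) (by omega) (by omega)
    (fun w => by rw [pageSide_eq_true]; omega)]
  omega

theorem pageCount_low_down {n i j : ℕ} (hij : i < j) (hj : j < n / 2) (h : n / 2 ≤ i + j) :
    pageCount n i j false + 1 + n / 2 = n := by
  rw [pageCount_eq (a := n / 2 - j) (b := i) (c := j + 1) (d := n - i) (e := n) (f := n)
    (by omega) (by omega) (by omega)
    (fun w => by rw [pageSide_eq_false]; omega)]
  omega

theorem pageCount_mid_up {n i j : ℕ} (hi : i < n / 2) (hj : n / 2 ≤ j) (hjn : j < n)
    (h : n ≤ i + j) : pageCount n i j true + 1 = i := by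
  rw [pageCount_eq (a := n - j) (b := i) (c := j + 1) (d := n) (e := n) (f := n)
    (by omega) (by omega) (by omega)
    (fun w => by rw [pageSide_eq_true]; omega)]
  omega

theorem pageCount_mid_down {n i j : ℕ} (hi : i < n / 2) (hj : n / 2 ≤ j)
    (h : i + j < n) : pageCount n i j false + 1 + j = n := by
  rw [pageCount_eq (a := 0) (b := i) (c := j + 1) (d := n - i) (e := n) (f := n)
    (by omega) (by omega) (by omega)
    (fun w => by rw [pageSide_eq_false]; omega)]
  omega

theorem pageCount_high_up {n i j : ℕ} (hi : n / 2 ≤ i) (hij : i < j) (hjn : j < n)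
    (h : i + j < n + n / 2) : pageCount n i j true + 1 = n / 2 := by
  rw [pageCount_eq (a := n - j) (b := i) (c := j + 1) (d := n + n / 2 - i) (e := n) (f := n)
    (by omega) (by omega) (by omega)
    (fun w => by rw [pageSide_eq_true]; omega)]
  omega

theorem pageCount_high_down {n i j : ℕ} (hi : n / 2 ≤ i) (hij : i < j) (hjn : j < n)
    (h : n + n / 2 ≤ i + j) : pageCount n i j false + (j - i) + 1 + n / 2 = n := by
  rw [pageCount_eq (a := 0) (b := n - j) (c := n + n / 2 - j) (d := i) (e := j + 1) (f := n)
    (by omega) (by omega) (by omega)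
    (fun w => by rw [pageSide_eq_false]; omega)]
  omega

/-- In the cases `pageCount_low_down` and `pageCount_high_up` both sides have at least `n / 2 - 1 >
t` vertices, so only the other four cases give shallow pairs. -/
theorem pageCount_shallow {n i j t : ℕ} (hij : i < j) (hjn : j < n) (ht : t + 2 ≤ n / 2)
    (hsum : pageCount n i j true + pageCount n i j false + 2 = n)
    (h : pageCount n i j true ≤ t ∨ pageCount n i j false ≤ t) :
    (i + j < n / 2 ∧ n / 2 ≤ t + 1 + (j - i)) ∨
    (n + n / 2 ≤ i + j ∧ n ≤ n / 2 + t + 1 + (j - i)) ∨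
    (n ≤ i + j ∧ i ≤ t + 1) ∨ (i + j < n ∧ n ≤ t + 1 + j) := by
  by_cases h1 : j < n / 2
  · by_cases h2 : i + j < n / 2
    · have := pageCount_low_up hij h2
      omega
    · have := pageCount_low_down hij h1 (by omega)
      omega
  · by_cases h2 : i < n / 2
    · by_cases h3 : n ≤ i + j
      · have := pageCount_mid_up h2 (by omega) hjn h3
        omega
      · have := pageCount_mid_down h2 (by omega) (by omega : i + j < n)
        omega
    · by_cases h3 : i + j < n + n / 2
      · have := pageCount_high_up (by omega) hij hjn h3
        omega
      · have := pageCount_high_down (by omega) hij hjn (by omega)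
        omega

theorem card_biUnion_antidiagonal_le (t : ℕ) :
    #((range (t + 1)).biUnion antidiagonal) ≤ (t + 2).choose 2 := by
  refine card_biUnion_le.trans (le_of_eq ?_)
  simp only [Nat.card_antidiagonal]
  induction t with
  | zero => simp
  | succ t ih =>
    rw [sum_range_succ, ih, Nat.choose_succ_succ' (t + 1 + 1) 1, Nat.choose_one_right]
    ring

/-- The four kinds of shallow pair fit into three copies of the triangle x + y ≤ t: the pairs within
the lower half and those within the upper half share one copy, split by x ≤ y and x > y. -/
theorem shallowPairs_pageSide_le {n t : ℕ} (ht : t + 2 ≤ n / 2) :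
    shallowPairs (fun i j w : Fin n => pageSide n i j w) t ≤ 3 * (t + 2).choose 2 := by
  set T : Finset (ℕ × ℕ) := (range (t + 1)).biUnion antidiagonal with hT
  have hmem : ∀ x y : ℕ, x + y ≤ t → (x, y) ∈ T := by
    intro x y h
    simp only [hT, mem_biUnion, mem_range, HasAntidiagonal.mem_antidiagonal]
    exact ⟨x + y, by omega, rfl⟩
  set U : Finset (ℕ × ℕ) := T.image (fun x => if x.1 ≤ x.2 then (x.1, n / 2 - 1 - x.2)
      else (x.1 + n / 2, n - 1 - x.2)) ∪ T.image (fun x => (x.1 + x.2 + 1, n - 1 - x.1)) ∪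
      T.image (fun x => (x.1, n - 1 - x.1 - x.2)) with hU
  have hcard : #U ≤ 3 * (t + 2).choose 2 := by
    have h1 := card_biUnion_antidiagonal_le t
    rw [← hT] at h1
    have h2 := card_union_le (T.image (fun x => if x.1 ≤ x.2 then (x.1, n / 2 - 1 - x.2)
      else (x.1 + n / 2, n - 1 - x.2)) ∪ T.image (fun x => (x.1 + x.2 + 1, n - 1 - x.1)))
      (T.image (fun x => (x.1, n - 1 - x.1 - x.2)))
    have h3 := card_union_le (T.image (fun x => if x.1 ≤ x.2 then (x.1, n / 2 - 1 - x.2)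
      else (x.1 + n / 2, n - 1 - x.2))) (T.image (fun x => (x.1 + x.2 + 1, n - 1 - x.1)))
    have h4 := card_image_le (s := T) (f := fun x => if x.1 ≤ x.2 then (x.1, n / 2 - 1 - x.2)
      else (x.1 + n / 2, n - 1 - x.2))
    have h5 := card_image_le (s := T) (f := fun x => (x.1 + x.2 + 1, n - 1 - x.1))
    have h6 := card_image_le (s := T) (f := fun x => (x.1, n - 1 - x.1 - x.2))
    rw [← hU] at h2
    omega
  refine le_trans ?_ hcard
  refine card_le_card_of_injOn (fun x => ((x.1 : ℕ), (x.2 : ℕ))) ?_ ?_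
  · rintro ⟨i, j⟩ hx
    simp only [mem_coe, mem_filter, mem_univ, true_and, sideCount_pageSide,
      otherCount_pageSide] at hx
    have hij : (i : ℕ) < j := hx.1
    have hsum := sideCount_add_otherCount (fun i j w : Fin n => pageSide n i j w) hx.1.ne
    rw [sideCount_pageSide, otherCount_pageSide] at hsum
    have h := pageCount_shallow hij j.2 ht hsum hx.2
    have hj := j.2
    simp only [hU, mem_coe, mem_union, mem_image]
    rcases h with h | h | h | h
    · refine Or.inl (Or.inl ⟨(i, n / 2 - 1 - j), hmem _ _ (by omega), ?_⟩)
      rw [if_pos (by simp only; omega)]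
      simp only [Prod.mk.injEq, true_and]
      omega
    · refine Or.inl (Or.inl ⟨(i - n / 2, n - 1 - j), hmem _ _ (by omega), ?_⟩)
      rw [if_neg (by simp only; omega)]
      simp only [Prod.mk.injEq]
      omega
    · refine Or.inl (Or.inr ⟨(n - 1 - j, i - 1 - (n - 1 - j)), hmem _ _ (by omega), ?_⟩)
      simp only [Prod.mk.injEq]
      omega
    · refine Or.inr ⟨(i, n - 1 - j - i), hmem _ _ (by omega), ?_⟩
      simp only [Prod.mk.injEq, true_and]
      omega
  · rintro ⟨i, j⟩ _ ⟨i', j'⟩ _ h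
    simp only [Prod.mk.injEq, Fin.val_inj] at h
    simp [h]

end TwoPage

/-! ### Parabolic arcs and their intersections. -/

section Arcs

theorem IsSimpleArc.symm {a b : Plane} {S : Set Plane} (h : IsSimpleArc a b S) :
    IsSimpleArc b a S := by
  obtain ⟨γ, hγ, rfl⟩ := h
  exact ⟨γ.symm, fun s t hst => unitInterval.symm_bijective.1 (hγ hst), γ.symm_range⟩

/-- The parabolic arc over the interval from `i` to `j` on the first axis. -/
def parabolicArc (s i j : ℝ) : Set Plane :=
  {P | i ≤ P 0 ∧ P 0 ≤ j ∧ P 1 = s * ((P 0 - i) * (j - P 0))}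

theorem isSimpleArc_parabolicArc (s : ℝ) {i j : ℝ} (hij : i < j) :
    IsSimpleArc !₂[i, 0] !₂[j, 0] (parabolicArc s i j) := by
  let γ : Path (!₂[i, 0] : Plane) !₂[j, 0] :=
    { toFun := fun t => !₂[i + t * (j - i), s * ((t * (j - i)) * ((1 - t) * (j - i)))]
      continuous_toFun := by fun_prop
      source' := by simp
      target' := by simp }
  have h0 : ∀ t, γ t 0 = i + t * (j - i) := fun t => rfl
  have h1 : ∀ t, γ t 1 = s * ((t * (j - i)) * ((1 - t) * (j - i))) := fun t => rfl
  have hd : 0 < j - i := by linarith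
  refine ⟨γ, fun t t' h => ?_, ?_⟩
  · have h' := congrArg (fun P : Plane => P 0) h
    simp only [h0] at h'
    exact Subtype.ext (mul_right_cancel₀ hd.ne' (by linarith))
  · ext P
    constructor
    · rintro ⟨t, rfl⟩
      refine ⟨?_, ?_, ?_⟩
      · rw [h0]; nlinarith [t.2.1]
      · rw [h0]; nlinarith [t.2.2]
      · rw [h0, h1]; ring
    · rintro ⟨hi, hj, hP⟩
      have ht : (P 0 - i) / (j - i) * (j - i) = P 0 - i := div_mul_cancel₀ _ hd.ne'
      refine ⟨⟨(P 0 - i) / (j - i), div_nonneg (by linarith) hd.le,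
        (div_le_one hd).2 (by linarith)⟩, Plane.ext_coord ?_ ?_⟩
      · rw [h0]
        simp only [ht]
        ring
      · rw [h1, hP]
        simp only [sub_mul, ht]
        ring

theorem mem_interior_of_mem_parabolicArc {s i j : ℝ} {P : Plane} (hP : P ∈ parabolicArc s i j)
    (hi : P ≠ !₂[i, 0]) (hj : P ≠ !₂[j, 0]) : i < P 0 ∧ P 0 < j := by
  obtain ⟨h1, h2, h3⟩ := hP
  refine ⟨lt_of_le_of_ne h1 fun h => hi ?_, lt_of_le_of_ne h2 fun h => hj ?_⟩
  · exact Plane.ext_coord h.symm (by rw [h3, ← h]; simp)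
  · exact Plane.ext_coord h (by rw [h3, ← h]; simp)

/-- Inside its interval an arc is strictly above or below the axis, so the signs agree. If one
interval contained the other, the arc over the larger would be strictly farther from the axis. -/
theorem parabolicArc_inter {s s' i j k l : ℝ} (hs : s = 1 ∨ s = -1) (hs' : s' = 1 ∨ s' = -1)
    (hne : ¬ (i = k ∧ j = l)) {P : Plane} (hP : P ∈ parabolicArc s i j)
    (hP' : P ∈ parabolicArc s' k l) (hij : i < P 0 ∧ P 0 < j) (hkl : k < P 0 ∧ P 0 < l) :
    s = s' ∧ (P 0 - i) * (j - P 0) = (P 0 - k) * (l - P 0) ∧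
      ((i < k ∧ k < j ∧ j < l) ∨ (k < i ∧ i < l ∧ l < j)) := by
  have h1 := hP.2.2
  have h2 := hP'.2.2
  have p1 : 0 < (P 0 - i) * (j - P 0) := mul_pos (by linarith) (by linarith)
  have p2 : 0 < (P 0 - k) * (l - P 0) := mul_pos (by linarith) (by linarith)
  have hss : s = s' := by
    rcases hs with rfl | rfl <;> rcases hs' with rfl | rfl <;> first | rfl | nlinarith
  subst hss
  have heq : (P 0 - i) * (j - P 0) = (P 0 - k) * (l - P 0) := by
    rcases hs with rfl | rfl <;> linarith
  refine ⟨rfl, heq, ?_⟩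
  rcases lt_trichotomy i k with h | h | h
  · refine Or.inl ⟨h, by linarith, ?_⟩
    by_contra hle
    push Not at hle
    have : (P 0 - k) * (l - P 0) < (P 0 - i) * (j - P 0) :=
      mul_lt_mul (by linarith) (by linarith) (by linarith) (by linarith)
    linarith
  · subst h
    have : j - P 0 = l - P 0 := mul_left_cancel₀
      (sub_pos.2 hij.1).ne' heq
    exact absurd ⟨rfl, by linarith⟩ hne
  · refine Or.inr ⟨h, by linarith, ?_⟩
    by_contra hle
    push Not at hle
    have : (P 0 - i) * (j - P 0) < (P 0 - k) * (l - P 0) :=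
      mul_lt_mul (by linarith) (by linarith) (by linarith) (by linarith)
    linarith

/-- Two parabolic arcs with interleaved ends meet in at most one inner point. -/
theorem parabolicArc_inter_unique {s a b c d : ℝ} (hab : a < b) (hcd : c < d) {P Q : Plane}
    (hP : P ∈ parabolicArc s a c) (hQ : Q ∈ parabolicArc s a c)
    (hP' : (P 0 - a) * (c - P 0) = (P 0 - b) * (d - P 0))
    (hQ' : (Q 0 - a) * (c - Q 0) = (Q 0 - b) * (d - Q 0)) : P = Q := by
  have h0 : P 0 = Q 0 := by
    -- The parabolas have equal leading coefficients, so their difference is linear in the abscissa.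
    have h : (b + d - a - c) * (P 0 - Q 0) = 0 := by linear_combination hQ' - hP'
    rcases mul_eq_zero.1 h with h | h
    · linarith
    · linarith
  exact Plane.ext_coord h0 (by rw [hP.2.2, hQ.2.2, h0])

end Arcs

/-! ### The two-page drawing and its crossings. -/

section TwoPageDrawing

variable (n : ℕ)

/-- The arc of the edge `i j`, for `i < j`. -/
def pageArc (i j : Fin n) : Set Plane :=
  parabolicArc (if pageUp n (i + j) then 1 else -1) i j

theorem sym2_eq_of_lt {n : ℕ} {i j k l : Fin n} (hij : i < j) (hkl : k < l)
    (h : s(i, j) = s(k, l)) : i = k ∧ j = l := by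
  rw [Sym2.eq_iff] at h
  omega

/-- The two-page drawing of the complete graph. -/
noncomputable def twoPageDrawing : Drawing (⊤ : SimpleGraph (Fin n)) where
  point i := !₂[(i : ℝ), 0]
  arc e := {P | ∃ i j : Fin n, i < j ∧ (e : Sym2 (Fin n)) = s(i, j) ∧ P ∈ pageArc n i j}
  point_injective i j h := by
    have := congrArg (fun P : Plane => P 0) h
    simp at this
    exact Fin.ext this
  isSimpleArc u v h := by
    have main : ∀ i j : Fin n, i < j →
        {P | ∃ i' j' : Fin n, i' < j' ∧ s(i, j) = s(i', j') ∧ P ∈ pageArc n i' j'} =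
          pageArc n i j := by
      intro i j hij
      ext P
      constructor
      · rintro ⟨i', j', h, he, hP⟩
        obtain ⟨rfl, rfl⟩ := sym2_eq_of_lt hij h he
        exact hP
      · intro hP
        exact ⟨i, j, hij, rfl, hP⟩
    rcases lt_or_gt_of_ne (show u ≠ v from h) with h | h
    · simp only [main u v h]
      exact isSimpleArc_parabolicArc _ (by exact_mod_cast h)
    · simp only [Sym2.eq_swap (a := u), main v u h]
      exact (isSimpleArc_parabolicArc _ (by exact_mod_cast h)).symm
  mem_of_point_mem_arc := by
    rintro e w ⟨i, j, hij, he, h1, h2, h3⟩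
    rw [he]
    simp only [Matrix.cons_val_zero, Matrix.cons_val_one] at h1 h2 h3
    have h4 : ((w : ℝ) - i) * (j - w) = 0 := by
      split_ifs at h3 <;> linarith
    rcases mul_eq_zero.1 h4 with h | h
    · have : w = i := Fin.ext (by exact_mod_cast (sub_eq_zero.1 h))
      simp [this]
    · have : w = j := Fin.ext (by exact_mod_cast (sub_eq_zero.1 h).symm)
      simp [this]

/-- The pairs of interleaved edges on the same page. -/
def pageCrossings : Finset (Fin n × Fin n × Fin n × Fin n) :=
  {x | (x.1 < x.2.1 ∧ x.2.1 < x.2.2.1 ∧ x.2.2.1 < x.2.2.2) ∧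
    pageUp n (x.1 + x.2.2.1) = pageUp n (x.2.1 + x.2.2.2)}

theorem twoPageDrawing_crossing {n : ℕ} {x : Sym2 (⊤ : SimpleGraph (Fin n)).edgeSet × Plane}
    (hx : x ∈ (twoPageDrawing n).crossings) :
    ∃ q ∈ pageCrossings n, x.1.map Subtype.val = s(s(q.1, q.2.2.1), s(q.2.1, q.2.2.2)) ∧
      x.2 ∈ pageArc n q.1 q.2.2.1 ∧ (x.2 0 - q.1) * (q.2.2.1 - x.2 0) =
        (x.2 0 - q.2.1) * (q.2.2.2 - x.2 0) := by
  obtain ⟨e, f, hx1, hef, ⟨i, j, hij, he, hP⟩, ⟨k, l, hkl, hf, hQ⟩, hv⟩ := hx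
  have hne : ¬ ((i : ℝ) = k ∧ (j : ℝ) = l) := by
    rintro ⟨h1, h2⟩
    have h1 : i = k := Fin.ext (by exact_mod_cast h1)
    have h2 : j = l := Fin.ext (by exact_mod_cast h2)
    exact hef (Subtype.ext (by rw [he, hf, h1, h2]))
  have hv' : ∀ w : Fin n, x.2 ≠ !₂[(w : ℝ), 0] := fun w h => hv ⟨w, h.symm⟩
  have m1 := mem_interior_of_mem_parabolicArc hP (hv' i) (hv' j)
  have m2 := mem_interior_of_mem_parabolicArc hQ (hv' k) (hv' l)
  have hsgn : ∀ b : Bool, ((if b then 1 else -1 : ℝ) = 1 ∨ (if b then 1 else -1 : ℝ) = -1) := by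
    intro b; cases b <;> simp
  obtain ⟨hs, heq, h⟩ := parabolicArc_inter (hsgn _) (hsgn _) hne hP hQ m1 m2
  have hup : pageUp n (i + j) = pageUp n (k + l) := by
    cases h1 : pageUp n (i + j) <;> cases h2 : pageUp n (k + l) <;> simp [h1, h2] at hs ⊢ <;>
      norm_num at hs
  have hmap : x.1.map Subtype.val = s(s(i, j), s(k, l)) := by
    rw [hx1, Sym2.map_mk, he, hf]
  rcases h with h | h
  · refine ⟨(i, k, j, l), ?_, hmap, hP, heq⟩
    simp only [pageCrossings, mem_filter, mem_univ, true_and]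
    exact ⟨by exact_mod_cast h, hup⟩
  · refine ⟨(k, i, l, j), ?_, hmap.trans Sym2.eq_swap, hQ, heq.symm⟩
    simp only [pageCrossings, mem_filter, mem_univ, true_and]
    exact ⟨by exact_mod_cast h, hup.symm⟩

/-- The quadruple determines both edges, and two interleaved arcs have at most one inner common
point, so sending a crossing to its quadruple is injective. -/
theorem twoPageDrawing_cr_le : (twoPageDrawing n).cr ≤ #(pageCrossings n) := by
  have h : ∀ x ∈ (twoPageDrawing n).crossings, ∃ q ∈ pageCrossings n,
      x.1.map Subtype.val = s(s(q.1, q.2.2.1), s(q.2.1, q.2.2.2)) ∧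
      x.2 ∈ pageArc n q.1 q.2.2.1 ∧ (x.2 0 - q.1) * (q.2.2.1 - x.2 0) =
        (x.2 0 - q.2.1) * (q.2.2.2 - x.2 0) := fun x hx => twoPageDrawing_crossing hx
  unfold Drawing.cr
  rcases (twoPageDrawing n).crossings.eq_empty_or_nonempty with h0 | ⟨x₀, hx₀⟩
  · simp [h0]
  have : Nonempty (Fin n × Fin n × Fin n × Fin n) := ⟨(h x₀ hx₀).choose⟩
  choose! g hg using h
  rw [← Set.encard_coe_eq_coe_finsetCard]
  refine Set.encard_le_encard_of_injOn (f := g) (fun x hx => mem_coe.2 (hg x hx).1) ?_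
  intro x hx y hy hxy
  obtain ⟨h1, h2, h3, h4⟩ := hg x hx
  obtain ⟨-, h2', h3', h4'⟩ := hg y hy
  rw [← hxy] at h2' h3' h4'
  simp only [pageCrossings, mem_filter] at h1
  refine Prod.ext (Sym2.map.injective Subtype.val_injective (h2.trans h2'.symm)) ?_
  exact parabolicArc_inter_unique (by exact_mod_cast h1.2.1.1) (by exact_mod_cast h1.2.1.2.2)
    h3 h3' h4 h4'

theorem card_pageCrossings : #(pageCrossings n) = sumQuad fun a b c d : Fin n =>
    if a < b ∧ b < c ∧ c < d then if pageUp n (a + c) = pageUp n (b + d) then 1 else 0 else 0 := by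
  unfold pageCrossings sumQuad
  rw [card_filter, Fintype.sum_prod_type]
  refine sum_congr rfl fun a _ => ?_
  rw [Fintype.sum_prod_type]
  refine sum_congr rfl fun b _ => ?_
  rw [Fintype.sum_prod_type]
  refine sum_congr rfl fun c _ => sum_congr rfl fun d _ => ?_
  exact ite_and ..

end TwoPageDrawing

/-! ### Rectilinear drawings: convex quadruples and shallow pairs. -/

section Rectilinear

theorem collinear_of_orient_eq_zero {a b c : Plane} (hab : a ≠ b) (h : orient a b c = 0) :
    Collinear ℝ ({a, b, c} : Set Plane) := by
  rw [collinear_iff_of_mem (p₀ := a) (by simp)]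
  refine ⟨b - a, ?_⟩
  have hpos : (b 0 - a 0) ^ 2 + (b 1 - a 1) ^ 2 ≠ 0 := by
    intro h0
    exact hab (Plane.ext_coord (by nlinarith [sq_nonneg (b 0 - a 0), sq_nonneg (b 1 - a 1)])
      (by nlinarith [sq_nonneg (b 0 - a 0), sq_nonneg (b 1 - a 1)]))
  unfold orient at h
  intro p hp
  rcases hp with rfl | rfl | rfl
  · exact ⟨0, by simp⟩
  · exact ⟨1, by simp⟩
  · refine ⟨((p 0 - a 0) * (b 0 - a 0) + (p 1 - a 1) * (b 1 - a 1)) /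
      ((b 0 - a 0) ^ 2 + (b 1 - a 1) ^ 2), Plane.ext_coord ?_ ?_⟩
    · simp only [vadd_eq_add, PiLp.add_apply, PiLp.smul_apply, PiLp.sub_apply, smul_eq_mul]
      field_simp
      linear_combination (b 1 - a 1) * h * (-1)
    · simp only [vadd_eq_add, PiLp.add_apply, PiLp.smul_apply, PiLp.sub_apply, smul_eq_mul]
      field_simp
      linear_combination (b 0 - a 0) * h

/-- Segments whose ends separate each other cross. -/
theorem exists_mem_segment_inter {a b c d : Plane}
    (h1 : orient a b c * orient a b d < 0) (h2 : orient c d a * orient c d b < 0) :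
    ∃ p, p ∈ segment ℝ a b ∧ p ∈ segment ℝ c d := by
  have ratio : ∀ x y : ℝ, x * y < 0 → x - y ≠ 0 ∧ 0 ≤ x / (x - y) ∧ 0 ≤ 1 - x / (x - y) := by
    intro x y hxy
    have hne : x - y ≠ 0 := by
      intro h
      have : x = y := by linarith
      subst this
      nlinarith [mul_self_nonneg x]
    refine ⟨hne, ?_, ?_⟩
    · rw [div_nonneg_iff]
      rcases mul_neg_iff.1 hxy with h | h
      · left; constructor <;> linarith
      · right; constructor <;> linarith
    · rw [one_sub_div hne, div_nonneg_iff]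
      rcases mul_neg_iff.1 hxy with h | h
      · left; constructor <;> linarith
      · right; constructor <;> linarith
  obtain ⟨n1, t1, t1'⟩ := ratio _ _ h1
  obtain ⟨n2, t2, t2'⟩ := ratio _ _ h2
  set t := orient c d a / (orient c d a - orient c d b) with ht
  set s := orient a b c / (orient a b c - orient a b d) with hs
  have e1 : t * (orient c d a - orient c d b) = orient c d a := div_mul_cancel₀ _ n2
  have e2 : s * (orient a b c - orient a b d) = orient a b c := div_mul_cancel₀ _ n1
  refine ⟨(1 - t) • a + t • b, ⟨1 - t, t, t2', t2, by ring, rfl⟩,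
    ⟨1 - s, s, t1', t1, by ring, ?_⟩⟩
  -- Both intersection parameters have the same denominator up to sign, so the two points can be
  -- compared after clearing it.
  have hd : orient a b c - orient a b d = -(orient c d a - orient c d b) := by
    unfold orient; ring
  refine Plane.ext_coord ?_ ?_ <;>
    simp only [PiLp.add_apply, PiLp.smul_apply, smul_eq_mul] <;>
    refine mul_right_cancel₀ n2 ?_
  · have e2' : s * (orient c d a - orient c d b) = -orient a b c := by rw [← e2, hd]; ring
    have : ((1 - s) * c 0 + s * d 0) * (orient c d a - orient c d b) -
      ((1 - t) * a 0 + t * b 0) * (orient c d a - orient c d b) = 0 := by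
      have : c 0 * (orient c d a - orient c d b) + (d 0 - c 0) * (-orient a b c) -
        a 0 * (orient c d a - orient c d b) - (b 0 - a 0) * orient c d a = 0 := by
        unfold orient; ring
      linear_combination this + (d 0 - c 0) * e2' - (b 0 - a 0) * e1
    linarith
  · have e2' : s * (orient c d a - orient c d b) = -orient a b c := by rw [← e2, hd]; ring
    have : ((1 - s) * c 1 + s * d 1) * (orient c d a - orient c d b) -
      ((1 - t) * a 1 + t * b 1) * (orient c d a - orient c d b) = 0 := by
      have : c 1 * (orient c d a - orient c d b) + (d 1 - c 1) * (-orient a b c) -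
        a 1 * (orient c d a - orient c d b) - (b 1 - a 1) * orient c d a = 0 := by
        unfold orient; ring
      linear_combination this + (d 1 - c 1) * e2' - (b 1 - a 1) * e1
    linarith

variable {n : ℕ}

/-- The vertex `w` lies to the left of the directed line from `i` to `j`. -/
noncomputable def leftSide (P : Fin n → Plane) (i j w : Fin n) : Bool :=
  decide (0 < orient (P i) (P j) (P w))

/-- No three of the points are on a line. -/
def GenPosFamily (P : Fin n → Plane) : Prop :=
  ∀ i j k : Fin n, i ≠ j → i ≠ k → j ≠ k → orient (P i) (P j) (P k) ≠ 0

theorem leftSide_swap {P : Fin n → Plane} (hP : GenPosFamily P) {i j w : Fin n} (h1 : i ≠ j)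
    (h2 : i ≠ w) (h3 : j ≠ w) : leftSide P j i w = !leftSide P i j w := by
  unfold leftSide
  rw [orient_swap, ← decide_not, decide_eq_decide, neg_pos, not_lt]
  exact ⟨le_of_lt, fun h => lt_of_le_of_ne h (hP i j w h1 h2 h3)⟩

theorem leftSide_rotate (P : Fin n → Plane) (i j w : Fin n) :
    leftSide P j w i = leftSide P i j w := by
  unfold leftSide
  rw [orient_rotate]

/-- All sides are determined by the orientations of the four triangles. The linear relation between
the signed areas rules out the two alternating sign patterns, and the other fourteen are checked by
`decide`. -/
theorem leftSide_sixSep {P : Fin n → Plane} (hP : GenPosFamily P) {a b c d : Fin n}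
    (hab : a < b) (hbc : b < c) (hcd : c < d) :
    2 ≤ sixSep (leftSide P) a b c d ∧ (sixSep (leftSide P) a b c d = 2 →
      (sep (leftSide P) a b c d = 1 ∧ sep (leftSide P) c d a b = 1) ∨
      (sep (leftSide P) a c b d = 1 ∧ sep (leftSide P) b d a c = 1) ∨
      (sep (leftSide P) a d b c = 1 ∧ sep (leftSide P) b c a d = 1)) := by
  have hac := hab.trans hbc
  have hbd := hbc.trans hcd
  have had := hac.trans hcd
  have r1 : leftSide P a c b = !leftSide P a b c := by
    rw [← leftSide_swap hP hab.ne hac.ne hbc.ne, leftSide_rotate P b a c]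
  have r2 : leftSide P a d b = !leftSide P a b d := by
    rw [← leftSide_swap hP hab.ne had.ne hbd.ne, leftSide_rotate P b a d]
  have r3 : leftSide P a d c = !leftSide P a c d := by
    rw [← leftSide_swap hP hac.ne had.ne hcd.ne, leftSide_rotate P c a d]
  have r4 : leftSide P b d c = !leftSide P b c d := by
    rw [← leftSide_swap hP hbc.ne hbd.ne hcd.ne, leftSide_rotate P c b d]
  have r5 := leftSide_rotate P a b c
  have r6 := leftSide_rotate P a b d
  have r7 := leftSide_rotate P a c d
  have r8 := leftSide_rotate P b c d
  have hsum : orient (P b) (P c) (P d) - orient (P a) (P c) (P d) + orient (P a) (P b) (P d) -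
      orient (P a) (P b) (P c) = 0 := by
    unfold orient; ring
  have n1 := hP b c d hbc.ne hbd.ne hcd.ne
  have n2 := hP a c d hac.ne had.ne hcd.ne
  have n3 := hP a b d hab.ne had.ne hbd.ne
  have n4 := hP a b c hab.ne hac.ne hbc.ne
  have x1 : ¬ (leftSide P b c d = true ∧ leftSide P a c d = false ∧ leftSide P a b d = true ∧
      leftSide P a b c = false) := by
    simp only [leftSide, decide_eq_true_eq, decide_eq_false_iff_not, not_lt]
    rintro ⟨h1, h2, h3, h4⟩
    linarith
  have x2 : ¬ (leftSide P b c d = false ∧ leftSide P a c d = true ∧ leftSide P a b d = false ∧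
      leftSide P a b c = true) := by
    simp only [leftSide, decide_eq_true_eq, decide_eq_false_iff_not, not_lt]
    rintro ⟨h1, h2, h3, h4⟩
    linarith
  simp only [sixSep, sep, r1, r2, r3, r4, r5, r6, r7]
  have r9 : leftSide P c d b = leftSide P b c d := by rw [leftSide_rotate P b c d]
  rw [r9]
  generalize leftSide P b c d = s1 at *
  generalize leftSide P a c d = s2 at *
  generalize leftSide P a b d = s3 at *
  generalize leftSide P a b c = s4 at *
  revert x1 x2
  clear * -
  revert s1 s2 s3 s4
  decide

theorem mul_neg_of_sep {P : Fin n → Plane} (hP : GenPosFamily P) {i j k l : Fin n} (hij : i ≠ j)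
    (hik : i ≠ k) (hil : i ≠ l) (hjk : j ≠ k) (hjl : j ≠ l)
    (h : sep (leftSide P) i j k l = 1) :
    orient (P i) (P j) (P k) * orient (P i) (P j) (P l) < 0 := by
  have h1 := hP i j k hij hik hjk
  have h2 := hP i j l hij hil hjl
  unfold sep leftSide at h
  rcases lt_or_gt_of_ne h1 with h1 | h1 <;> rcases lt_or_gt_of_ne h2 with h2 | h2
  · simp [h1.not_gt, h2.not_gt] at h
  · exact mul_neg_of_neg_of_pos h1 h2
  · exact mul_neg_of_pos_of_neg h1 h2
  · simp [h1, h2] at h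

variable {D : Drawing (⊤ : SimpleGraph (Fin n))}

theorem Drawing.IsRectilinear.genPosFamily (hD : D.IsRectilinear) : GenPosFamily D.point :=
  fun i j k hij hik hjk h => hD.1 i j k hij hik hjk
    (collinear_of_orient_eq_zero (fun h => hij (D.point_injective h)) h)

/-- The end vertices of the edges of a crossing. -/
def crossingSupport (x : Sym2 (⊤ : SimpleGraph (Fin n)).edgeSet × Plane) : Set (Fin n) :=
  {v | ∃ e ∈ x.1, v ∈ (e : Sym2 (Fin n))}

theorem exists_crossing (hD : D.IsRectilinear) {i j k l : Fin n} (hij : i ≠ j) (hik : i ≠ k)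
    (hil : i ≠ l) (hjk : j ≠ k) (hjl : j ≠ l) (hkl : k ≠ l)
    (h1 : sep (leftSide D.point) i j k l = 1) (h2 : sep (leftSide D.point) k l i j = 1) :
    ∃ x ∈ D.crossings, crossingSupport x = {i, j, k, l} := by
  obtain ⟨p, hp1, hp2⟩ := exists_mem_segment_inter
    (mul_neg_of_sep hD.genPosFamily hij hik hil hjk hjl h1)
    (mul_neg_of_sep hD.genPosFamily hkl hik.symm hjk.symm hil.symm hjl.symm h2)
  have a1 : (⊤ : SimpleGraph (Fin n)).Adj i j := hij
  have a2 : (⊤ : SimpleGraph (Fin n)).Adj k l := hkl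
  rw [← hD.2 i j a1] at hp1
  rw [← hD.2 k l a2] at hp2
  refine ⟨(s(⟨s(i, j), a1⟩, ⟨s(k, l), a2⟩), p), ⟨_, _, rfl, ?_, hp1, hp2, ?_⟩, ?_⟩
  · intro h
    have := congrArg Subtype.val h
    simp [hik, hil] at this
  · rintro ⟨w, rfl⟩
    have m1 := D.mem_of_point_mem_arc _ w hp1
    have m2 := D.mem_of_point_mem_arc _ w hp2
    simp only [Sym2.mem_iff] at m1 m2
    rcases m1 with rfl | rfl <;> rcases m2 with rfl | rfl <;> contradiction
  · ext v
    simp [crossingSupport]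
    tauto

/-- The quadruples in convex position. -/
noncomputable def convexQuads (P : Fin n → Plane) : Finset (Fin n × Fin n × Fin n × Fin n) :=
  {x | (x.1 < x.2.1 ∧ x.2.1 < x.2.2.1 ∧ x.2.2.1 < x.2.2.2) ∧
    sixSep (leftSide P) x.1 x.2.1 x.2.2.1 x.2.2.2 = 2}

theorem sorted_eq_of_support_eq {a b c d a' b' c' d' : Fin n} (hab : a < b) (hbc : b < c)
    (hcd : c < d) (hab' : a' < b') (hbc' : b' < c') (hcd' : c' < d')
    (h : ({a, b, c, d} : Set (Fin n)) = {a', b', c', d'}) : (a, b, c, d) = (a', b', c', d') := by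
  have h1 : ∀ v, (v = a ∨ v = b ∨ v = c ∨ v = d) ↔ (v = a' ∨ v = b' ∨ v = c' ∨ v = d') :=
    fun v => by simpa using Set.ext_iff.1 h v
  have ha : a = a' := by
    have := (h1 a).1 (by simp)
    have := (h1 a').2 (by simp)
    omega
  have hd : d = d' := by
    have := (h1 d).1 (by simp)
    have := (h1 d').2 (by simp)
    omega
  subst ha hd
  have hb : b = b' := by
    have := (h1 b).1 (by simp)
    have := (h1 b').2 (by simp)
    omega
  subst hb
  have hc : c = c' := by
    have := (h1 c).1 (by simp)
    omega
  rw [hc]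

/-- The chosen crossing has the quadruple as its set of end vertices, so different quadruples give
different crossings. -/
theorem card_convexQuads_le (hD : D.IsRectilinear) : (#(convexQuads D.point) : ℕ∞) ≤ D.cr := by
  have h : ∀ q ∈ convexQuads D.point, ∃ x ∈ D.crossings,
      crossingSupport x = {q.1, q.2.1, q.2.2.1, q.2.2.2} := by
    rintro ⟨a, b, c, d⟩ hq
    simp only [convexQuads, mem_filter, mem_univ, true_and] at hq ⊢
    obtain ⟨⟨hab, hbc, hcd⟩, hq⟩ := hq
    have hac := hab.trans hbc
    have hbd := hbc.trans hcd
    have had := hac.trans hcd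
    rcases (leftSide_sixSep hD.genPosFamily hab hbc hcd).2 hq with h | h | h
    · exact exists_crossing hD hab.ne hac.ne had.ne hbc.ne hbd.ne hcd.ne h.1 h.2
    · obtain ⟨x, hx, hs⟩ :=
        exists_crossing hD hac.ne hab.ne had.ne hbc.ne' hcd.ne hbd.ne h.1 h.2
      refine ⟨x, hx, hs.trans ?_⟩
      ext v; simp; tauto
    · obtain ⟨x, hx, hs⟩ :=
        exists_crossing hD had.ne hab.ne hac.ne hbd.ne' hcd.ne' hbc.ne h.1 h.2
      refine ⟨x, hx, hs.trans ?_⟩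
      ext v; simp; tauto
  rcases (convexQuads D.point).eq_empty_or_nonempty with h0 | ⟨q₀, hq₀⟩
  · simp [h0]
  have : Nonempty (Sym2 (⊤ : SimpleGraph (Fin n)).edgeSet × Plane) := ⟨(h q₀ hq₀).choose⟩
  choose! g hg using h
  unfold Drawing.cr
  rw [← Set.encard_coe_eq_coe_finsetCard]
  refine Set.encard_le_encard_of_injOn (f := g) (fun x hx => (hg x hx).1) ?_
  rintro ⟨a, b, c, d⟩ hx ⟨a', b', c', d'⟩ hy hxy
  have h1 := (hg _ hx).2
  have h2 := (hg _ hy).2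
  rw [hxy, h2] at h1
  simp only [convexQuads, mem_coe, mem_filter, mem_univ, true_and] at hx hy
  exact (sorted_eq_of_support_eq hy.1.1 hy.1.2.1 hy.1.2.2 hx.1.1 hx.1.2.1 hx.1.2.2 h1).symm

theorem card_convexQuads (P : Fin n → Plane) : #(convexQuads P) = sumQuad fun a b c d : Fin n =>
    if a < b ∧ b < c ∧ c < d then if sixSep (leftSide P) a b c d = 2 then 1 else 0 else 0 := by
  unfold convexQuads sumQuad
  rw [card_filter, Fintype.sum_prod_type]
  refine sum_congr rfl fun a _ => ?_
  rw [Fintype.sum_prod_type]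
  refine sum_congr rfl fun b _ => ?_
  rw [Fintype.sum_prod_type]
  refine sum_congr rfl fun c _ => sum_congr rfl fun d _ => ?_
  exact ite_and ..

open scoped Classical in
/-- The set of points of a family. -/
noncomputable def pointSet (P : Fin n → Plane) : Finset Plane := univ.image P

theorem GenPosFamily.pointSet {P : Fin n → Plane} (hP : GenPosFamily P) :
    GenPos (pointSet P) := by
  intro a ha b hb c hc
  simp only [GraphDrawing.pointSet, mem_image, mem_univ, true_and] at ha hb hc
  obtain ⟨i, rfl⟩ := ha
  obtain ⟨j, rfl⟩ := hb
  obtain ⟨k, rfl⟩ := hc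
  exact fun h1 h2 h3 => hP i j k (ne_of_apply_ne P h1) (ne_of_apply_ne P h2) (ne_of_apply_ne P h3)

theorem card_pointSet {P : Fin n → Plane} (hP : Function.Injective P) : #(pointSet P) = n := by
  classical
  rw [pointSet, card_image_of_injective _ hP, card_univ, Fintype.card_fin]

theorem sideCount_leftSide {P : Fin n → Plane} (hP : Function.Injective P) (i j : Fin n) :
    sideCount (leftSide P) i j = left (pointSet P) (P i) (P j) := by
  classical
  unfold left pointSet sideCount
  rw [filter_image, card_image_of_injective _ hP]
  congr 1
  ext w
  simp only [mem_filter, mem_univ, true_and, leftSide, decide_eq_true_eq]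
  constructor
  · exact fun h => h.2.2
  · refine fun h => ⟨?_, ?_, h⟩ <;> rintro rfl <;> simp at h

theorem fewLeft_le_shallowPairs {P : Fin n → Plane} (hinj : Function.Injective P)
    (hP : GenPosFamily P) {t : ℕ} (ht : 2 * t + 3 ≤ n) :
    fewLeft (pointSet P) (t + 1) ≤ shallowPairs (leftSide P) t := by
  classical
  have hother : ∀ i j : Fin n, i ≠ j →
      otherCount (leftSide P) i j = left (pointSet P) (P j) (P i) := by
    intro i j hij
    have h1 := sideCount_add_otherCount (leftSide P) hij
    have h2 := left_add_left hP.pointSet (mem_image_of_mem P (mem_univ i))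
      (mem_image_of_mem P (mem_univ j)) (fun h => hij (hinj h))
    rw [card_pointSet hinj] at h2
    rw [sideCount_leftSide hinj] at h1
    omega
  set A : Finset (Fin n × Fin n) := {x | x.1 < x.2 ∧ left (pointSet P) (P x.1) (P x.2) ≤ t}
  set B : Finset (Fin n × Fin n) := {x | x.1 < x.2 ∧ left (pointSet P) (P x.2) (P x.1) ≤ t}
  -- The two left counts add up to `n - 2 ≥ 2 * t + 1`, so they cannot both be at most `t`.
  have hAB : Disjoint A B := by
    refine disjoint_filter.2 fun x _ h h' => ?_
    have := left_add_left hP.pointSet (mem_image_of_mem P (mem_univ x.1))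
      (mem_image_of_mem P (mem_univ x.2)) (fun e => h.1.ne (hinj e))
    rw [card_pointSet hinj] at this
    omega
  have hsh : shallowPairs (leftSide P) t = #A + #B := by
    rw [← card_union_of_disjoint hAB, ← filter_or]
    unfold shallowPairs
    refine congrArg card (filter_congr fun x _ => ?_)
    rw [← and_or_left]
    exact and_congr_right fun h => by rw [sideCount_leftSide hinj, hother _ _ h.ne]
  rw [hsh]
  refine le_trans (card_le_card (t := A.image (fun x => (P x.1, P x.2)) ∪
    B.image (fun x => (P x.2, P x.1))) ?_)
    ((card_union_le _ _).trans (Nat.add_le_add card_image_le card_image_le))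
  rintro ⟨a, b⟩ hx
  obtain ⟨hx, hne, hl⟩ := mem_filter.1 hx
  simp only [pointSet, mem_product, mem_image, mem_univ, true_and] at hx
  obtain ⟨⟨i, rfl⟩, j, rfl⟩ := hx
  simp only at hl
  rcases lt_or_gt_of_ne (ne_of_apply_ne P hne) with h | h
  · exact mem_union_left _ (mem_image.2
      ⟨(i, j), mem_filter.2 ⟨mem_univ _, h, Nat.le_of_lt_succ hl⟩, rfl⟩)
  · exact mem_union_right _ (mem_image.2
      ⟨(j, i), mem_filter.2 ⟨mem_univ _, h, Nat.le_of_lt_succ hl⟩, rfl⟩)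

end Rectilinear

/-! ### Comparison of the two counts. -/

/-- Every rectilinear drawing has more crossings than the two-page drawing. -/
theorem card_pageCrossings_lt {n : ℕ} (hn : 10 ≤ n) {P : Fin n → Plane}
    (hinj : Function.Injective P) (hP : GenPosFamily P) :
    #(pageCrossings n) < #(convexQuads P) := by
  have h1 : #(pageCrossings n) + ∑ t ∈ range (n / 2 - 1), (n - 3 - 2 * t) *
      deepPairs (fun i j w : Fin n => pageSide n i j w) t =
      sumQuad fun a b c d : Fin n => if a < b ∧ b < c ∧ c < d then 3 else 0 := by
    rw [← sum_sixSep_eq_sum_deepPairs, card_pageCrossings, ← sumQuad_add]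
    congr 1
    funext a b c d
    split_ifs with h
    all_goals
      first
      | rfl
      | (have := pageSide_sixSep h.1 h.2.1 h.2.2
         simp_all)
  have h2 : (sumQuad fun a b c d : Fin n => if a < b ∧ b < c ∧ c < d then 3 else 0) ≤
      #(convexQuads P) + ∑ t ∈ range (n / 2 - 1), (n - 3 - 2 * t) * deepPairs (leftSide P) t := by
    rw [← sum_sixSep_eq_sum_deepPairs, card_convexQuads, ← sumQuad_add]
    refine sum_le_sum fun a _ => sum_le_sum fun b _ => sum_le_sum fun c _ =>
      sum_le_sum fun d _ => ?_
    by_cases h : a < b ∧ b < c ∧ c < d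
    · simp only [if_pos h]
      have := (leftSide_sixSep hP h.1 h.2.1 h.2.2).1
      split_ifs <;> omega
    · simp only [if_neg h]
      omega
  have hdeep : ∀ t ∈ range (n / 2 - 1),
      deepPairs (leftSide P) t + fewLeft (pointSet P) (t + 1) ≤
        deepPairs (fun i j w : Fin n => pageSide n i j w) t + 3 * (t + 2).choose 2 := by
    intro t ht
    rw [mem_range] at ht
    have e1 := deepPairs_add_shallowPairs (leftSide P) t
    have e2 := deepPairs_add_shallowPairs (fun i j w : Fin n => pageSide n i j w) t
    have e3 := fewLeft_le_shallowPairs hinj hP (t := t) (by omega)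
    have e4 := shallowPairs_pageSide_le (n := n) (t := t) (by omega)
    omega
  have hcard := card_pointSet hinj
  -- The least `K` with `n < 3 * (K + 1)`. For `n ≥ 10` it satisfies `n / 3 < n / 2 - 1`, so the
  -- strict level lies in the range of summation; this fails for `n = 9`.
  obtain ⟨k, hk, hk1, hlt⟩ := exists_fewLeft_gt hP.pointSet (K := n / 3)
    (by rw [hcard]; omega) (by rw [hcard]; omega)
  obtain ⟨t, rfl⟩ := Nat.exists_eq_add_of_le' hk1
  have hsum : ∑ t ∈ range (n / 2 - 1), (n - 3 - 2 * t) * deepPairs (leftSide P) t <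
      ∑ t ∈ range (n / 2 - 1), (n - 3 - 2 * t) *
        deepPairs (fun i j w : Fin n => pageSide n i j w) t := by
    refine sum_lt_sum (fun t ht => Nat.mul_le_mul_left _ ?_) ⟨t, ?_, ?_⟩
    · have h3 := hdeep t ht
      rw [mem_range] at ht
      have h4 := fewLeft_ge (t + 1) hP.pointSet (by rw [hcard]; omega)
      rw [show t + 1 + 1 = t + 2 from rfl] at h4
      omega
    · rw [mem_range]
      omega
    · have h3 := hdeep t (by rw [mem_range]; omega)
      rw [show t + 1 + 1 = t + 2 from rfl] at hlt
      exact Nat.mul_lt_mul_of_pos_left (by omega) (by omega)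
  omega

end GraphDrawing

theorem mainTheorem10 (n : ℕ) (hn : 10 ≤ n) :
    GraphDrawing.crossingNumber (⊤ : SimpleGraph (Fin n)) <
      GraphDrawing.rectilinearCrossingNumber (⊤ : SimpleGraph (Fin n)) := by
  have h1 : GraphDrawing.crossingNumber (⊤ : SimpleGraph (Fin n)) ≤
      ((GraphDrawing.pageCrossings n).card : ℕ∞) :=
    (iInf_le _ _).trans (GraphDrawing.twoPageDrawing_cr_le n)
  -- The gap of one is uniform over all drawings, so strictness survives the infimum.
  have h2 : (((GraphDrawing.pageCrossings n).card + 1 : ℕ) : ℕ∞) ≤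
      GraphDrawing.rectilinearCrossingNumber (⊤ : SimpleGraph (Fin n)) := by
    refine le_iInf₂ fun D hD => le_trans ?_ (GraphDrawing.card_convexQuads_le hD)
    exact_mod_cast GraphDrawing.card_pageCrossings_lt hn D.point_injective hD.genPosFamily
  refine h1.trans_lt (lt_of_lt_of_le ?_ h2)
  exact_mod_cast Nat.lt_succ_self _
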